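/- **Setting.** Let $d,m\ge 0$ and $T\ge 1$ be integers and $B\ge 1$. Let $\mathcal X\subset\mathbb R^d$ be compact and convex, and let $f,g_1,\dots,g_m\in\mathbb R^d$ satisfy $\|f\|_2\le B$ and $\|g_i\|_2\le B$. Assume that the benchmark problem of maximizing $\langle f,x\rangle$ over $x\in\mathcal X$ with $\langle g_i,x\rangle\le 0$ for all $i\in[m]$ is feasible, and let $x_{\mathrm{OPT}}$ be a maximizer. No Slater (strict feasibility) condition is assumed. In round $t=1,\dots,T$ the learner plays $x_t\in\mathcal X$ and observes $$f_t(x_t)=\langle f,x_t\rangle+\epsilon_t,\qquad g_{t,i}(x_t)=\langle g_i,x_t\rangle+\epsilon_{t,i}\quad(i\in[m]).$$ There is a filtration $(\mathcal F_t)_{t\ge 0}$ such that $x_t$ is $\mathcal F_{t-1}$-measurable, $\epsilon_t$ and $\epsilon_{t,i}$ are $\mathcal F_t$-measurable, and each noise variable $\eta\in\{\epsilon_t,\epsilon_{t,1},\dots,\epsilon_{t,m}\}$ is conditionally 1-sub-Gaussian: $\mathbb E[e^{a\eta}\mid\mathcal F_{t-1}]\le e^{a^2/2}$ for all $a\in\mathbb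 R$. **Algorithm.** Let $\lambda>0$ and $\delta=1/T$. For $t\ge 0$ put $$V_t=\lambda I+\sum_{s=1}^t x_sx_s^{\top},\qquad \widehat f_t=V_t^{-1}\sum_{s=1}^t f_s(x_s)x_s,\qquad \widehat g_{i,t}=V_t^{-1}\sum_{s=1}^t g_{s,i}(x_s)x_s,$$ $$\beta_t=\sqrt{d\log\Big(1+\frac{tB^2/\lambda}{\delta}\Big)}+\sqrt\lambda\,B,$$ and, with $\|v\|_V=\sqrt{v^\top Vv}$, define the confidence ellipsoids $$C_{f,t}=\{f':\|\widehat f_t-f'\|_{V_t}\le\beta_t\},\qquad C_{g_i,t}=\{g':\|\widehat g_{i,t}-g'\|_{V_t}\le\beta_t\}.$$ For $t=0,\dots,T-1$, the action $x_{t+1}$ is the $x$-component of a maximizer (ties broken arbitrarily) of $$\max\big\{\langle f',x\rangle:\ x\in\mathcal X,\ f'\in C_{f,t},\ g_i'\in C_{g_i,t},\ \langle g_i',x\rangle\le 0\ \text{ for all } i\in[m]\big\}.$$ If this program is infeasible, $x_{t+1}\in\mathcal X$ is arbitrary. **Theorem.** There is a universal $k\in\mathbb N$ such that for all $0<\lambda_0\le\lambda_1$,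 all $\kappa\ge0$ and all $m$ there is a constant $C$, depending only on $(\lambda_0,\lambda_1,\kappa,m)$, with the following property. In the setting above, with $\lambda_0\le\lambda\le\lambda_1$ (that is, $\lambda=\Theta(1)$) and $\max_{x\in\mathcal X}\|x\|_2\le\kappa\min\{B,\sqrt T\}$ (for a fixed action set this holds for every $T\ge1$ and $B\ge1$ with $\kappa=\max_{x\in\mathcal X}\|x\|_2$), $$\mathrm{Regret}:=T\langle f,x_{\mathrm{OPT}}\rangle-\mathbb E\Big[\sum_{t=1}^T f_t(x_t)\Big]\ \le\ C\,dB\sqrt T\,\log^k(1+T)=\widetilde O(dB\sqrt T),$$ and, for every $i\in[m]$, the expected constraint violation satisfies $$\mathbb E\Big[\sum_{t=1}^T g_{t,i}(x_t)\Big]\ \le\ C\,dB\sqrt T\,\log^k(1+T)=\widetilde O(dB\sqrt T),$$ where both expectations are of integrable random variables. -/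

import Mathlib

open MeasureTheory ProbabilityTheory
open scoped Matrix BigOperators

noncomputable section

/-- The regularized design matrix `V_t = lam • I + ∑_{s < t} x_s x_sᵀ` after `t` rounds
(rounds are numbered from `0`, so these are the first `t` rounds). -/
def designMatrix {d : ℕ} (lam : ℝ) (x : ℕ → EuclideanSpace ℝ (Fin d)) (t : ℕ) :
    Matrix (Fin d) (Fin d) ℝ :=
  lam • (1 : Matrix (Fin d) (Fin d) ℝ) +
    ∑ s ∈ Finset.range t, Matrix.vecMulVec (x s).ofLp (x s).ofLp

/-- The regularized least squares estimator `V_t⁻¹ ∑_{s < t} y_s x_s` after `t` rounds. -/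
def olsEstimator {d : ℕ} (lam : ℝ) (x : ℕ → EuclideanSpace ℝ (Fin d)) (y : ℕ → ℝ) (t : ℕ) :
    EuclideanSpace ℝ (Fin d) :=
  WithLp.toLp 2 ((designMatrix lam x t)⁻¹ *ᵥ ∑ s ∈ Finset.range t, y s • (x s).ofLp)

/-- The weighted norm `‖v‖_V = √(vᵀ V v)`. -/
def weightedNorm {d : ℕ} (V : Matrix (Fin d) (Fin d) ℝ) (v : EuclideanSpace ℝ (Fin d)) : ℝ :=
  Real.sqrt (v.ofLp ⬝ᵥ (V *ᵥ v.ofLp))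

/-- The confidence radius `β_t = √(d log(1 + (t B² / lam) / δ)) + √lam B`. -/
def confRadius (d : ℕ) (B lam δ : ℝ) (t : ℕ) : ℝ :=
  Real.sqrt (d * Real.log (1 + ((t : ℝ) * B ^ 2 / lam) / δ)) + Real.sqrt lam * B

/-- The confidence ellipsoid after `t` rounds, centred at the least squares estimator. -/
def confSet {d : ℕ} (B lam δ : ℝ) (x : ℕ → EuclideanSpace ℝ (Fin d)) (y : ℕ → ℝ) (t : ℕ) :
    Set (EuclideanSpace ℝ (Fin d)) :=
  {θ | weightedNorm (designMatrix lam x t) (olsEstimator lam x y t - θ) ≤ confRadius d B lam δ t}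

/-- Feasible points `(x, f', g')` of the doubly optimistic program: an action, a reward parameter
and constraint parameters from the confidence sets, with `⟨g'_i, x⟩ ≤ 0` for all `i`. -/
def optimisticFeasible {d m : ℕ} (X Cf : Set (EuclideanSpace ℝ (Fin d)))
    (Cg : Fin m → Set (EuclideanSpace ℝ (Fin d))) :
    Set (EuclideanSpace ℝ (Fin d) × EuclideanSpace ℝ (Fin d) ×
      (Fin m → EuclideanSpace ℝ (Fin d))) :=
  {p | p.1 ∈ X ∧ p.2.1 ∈ Cf ∧ ∀ i, p.2.2 i ∈ Cg i ∧ inner ℝ (p.2.2 i) p.1 ≤ 0}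

/-- `x` is an admissible choice of the doubly optimistic rule: it is an action, and it is the
action part of a maximizer of `⟨f', x⟩` over the optimistic program whenever that program has a
feasible point (otherwise the rule leaves the action free). -/
def IsOptimisticAction {d m : ℕ} (X Cf : Set (EuclideanSpace ℝ (Fin d)))
    (Cg : Fin m → Set (EuclideanSpace ℝ (Fin d))) (x : EuclideanSpace ℝ (Fin d)) : Prop :=
  x ∈ X ∧ ((optimisticFeasible X Cf Cg).Nonempty →
    ∃ (f' : EuclideanSpace ℝ (Fin d)) (g' : Fin m → EuclideanSpace ℝ (Fin d)),
      (x, f', g') ∈ optimisticFeasible X Cf Cg ∧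
      ∀ q ∈ optimisticFeasible X Cf Cg, inner ℝ q.2.1 q.1 ≤ inner ℝ f' x)

/-- The noisy observation `⟨θ, x_t⟩ + ε_t` in round `t`. -/
def observation {Ω : Type*} {d : ℕ} (θ : EuclideanSpace ℝ (Fin d))
    (x : ℕ → Ω → EuclideanSpace ℝ (Fin d)) (ε : ℕ → Ω → ℝ) (t : ℕ) (ω : Ω) : ℝ :=
  inner ℝ θ (x t ω) + ε t ω

/-- The actions `x` of the first `T` rounds are chosen by the UCB-based algorithm with
regularization `lam` and confidence parameter `δ`: in round `t` the doubly optimistic rule is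
applied to the confidence sets built from the `t` earlier rounds. -/
def IsUCBRun {Ω : Type*} {d m : ℕ} (B lam δ : ℝ) (T : ℕ)
    (X : Set (EuclideanSpace ℝ (Fin d))) (f : EuclideanSpace ℝ (Fin d))
    (g : Fin m → EuclideanSpace ℝ (Fin d)) (εf : ℕ → Ω → ℝ) (εg : Fin m → ℕ → Ω → ℝ)
    (x : ℕ → Ω → EuclideanSpace ℝ (Fin d)) : Prop :=
  ∀ ω, ∀ t < T, IsOptimisticAction X
    (confSet B lam δ (fun s => x s ω) (fun s => observation f x εf s ω) t)
    (fun i => confSet B lam δ (fun s => x s ω) (fun s => observation (g i) x (εg i) s ω) t)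
    (x t ω)

/-- `ε` is conditionally 1-sub-Gaussian given the sigma-algebra `ℋ`. -/
def CondSubGaussian {Ω : Type*} [mΩ : MeasurableSpace Ω] (μ : Measure Ω)
    (ℋ : MeasurableSpace Ω) (ε : Ω → ℝ) : Prop :=
  ∀ a : ℝ, Integrable (fun ω => Real.exp (a * ε ω)) μ ∧
    μ[fun ω => Real.exp (a * ε ω) | ℋ] ≤ᵐ[μ] fun _ => Real.exp (a ^ 2 / 2)

/-- A 1-sub-Gaussian noise sequence over `T` rounds: the noise of round `t` is revealed at the
end of that round and is conditionally 1-sub-Gaussian given the information `ℱ t` available when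
the action of round `t` is chosen. -/
def IsSubGaussianNoise {Ω : Type*} [mΩ : MeasurableSpace Ω] (μ : Measure Ω)
    (ℱ : Filtration ℕ mΩ) (T : ℕ) (ε : ℕ → Ω → ℝ) : Prop :=
  ∀ t < T, StronglyMeasurable[ℱ (t + 1)] (ε t) ∧ CondSubGaussian μ (ℱ t) (ε t)

/-- The feasible set of the stationary benchmark. -/
def benchmarkSet {d m : ℕ} (X : Set (EuclideanSpace ℝ (Fin d)))
    (g : Fin m → EuclideanSpace ℝ (Fin d)) : Set (EuclideanSpace ℝ (Fin d)) :=
  {x | x ∈ X ∧ ∀ i, inner ℝ (g i) x ≤ 0}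

/-- The regret `T ⟨f, x_OPT⟩ - 𝔼[∑_t f_t(x_t)]`. -/
def banditRegret {Ω : Type*} [MeasurableSpace Ω] {d : ℕ} (μ : Measure Ω) (T : ℕ)
    (f xopt : EuclideanSpace ℝ (Fin d)) (εf : ℕ → Ω → ℝ)
    (x : ℕ → Ω → EuclideanSpace ℝ (Fin d)) : ℝ :=
  T * inner ℝ f xopt - ∫ ω, ∑ t ∈ Finset.range T, observation f x εf t ω ∂μ

end

/-! The argument is optimism plus the elliptical potential, with confidence failures counted in
expectation round by round.

If in round `t` all true parameters lie in their ellipsoids, then the benchmark point together with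
the true parameters is feasible for the optimistic program. Hence the regret of the round, and each
constraint value, is an error between two parameters of one ellipsoid in the direction played, at
most `2 β_t w_t` with `w_t = ‖x_t‖_{V_t⁻¹}` (`IsUCBRun.loss_le`). Feasibility of the benchmark is
enough; no slack enters. Since `∑ min(1, w_t²) = O(d log T)` (`sum_min_one_designWidth_sq_le`),
Cauchy-Schwarz gives `β √(dT)` up to logarithms. The rounds with `w_t > 1` number only `O(d log T)`
and each costs at most `2BL`, where `L ≤ κ√T` bounds the actions (`sum_loss_le`).

A failing round also costs at most `2BL = O(B√T)`, so the expected number of failures must be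
polylogarithmic. A failure means that the self-normalized noise `Q_t = ‖S_t‖²_{V_t⁻¹}`, with `S_t`
the accumulated noise, exceeds `d log b`, where `b = 1 + tB²T/λ`. Gaussian mixtures bound its
probability by `(a/b)^{d/2}` with `a = 1 + tL²/λ` and `a/b = O(1/T)`. For `d ≥ 2` this sums to a
constant (`sum_failureSet_le_of_two_le`). For `d = 1` it would allow order `√T` failures, which is
too many; a union bound over a geometric grid of exponential parameters removes the factor `√a` at
the price of logarithms (`sum_failureSet_one_le`). -/

/-! ### Weighted norms and the algebra of the design matrix. -/

/-- Cauchy-Schwarz for the bilinear form of a positive semidefinite matrix. -/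
theorem Matrix.PosSemidef.sq_dotProduct_mulVec_le {d : ℕ} {V : Matrix (Fin d) (Fin d) ℝ}
    (hV : V.PosSemidef) (u v : Fin d → ℝ) :
    (u ⬝ᵥ (V *ᵥ v)) ^ 2 ≤ (u ⬝ᵥ (V *ᵥ u)) * (v ⬝ᵥ (V *ᵥ v)) := by
  have hs : v ⬝ᵥ (V *ᵥ u) = u ⬝ᵥ (V *ᵥ v) := by
    have hT : Vᵀ = V := by simpa [Matrix.IsHermitian] using hV.isHermitian
    rw [Matrix.dotProduct_mulVec, ← Matrix.mulVec_transpose, hT, dotProduct_comm]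
  have h : ∀ c : ℝ, 0 ≤ (v ⬝ᵥ (V *ᵥ v)) * (c * c) + (2 * (u ⬝ᵥ (V *ᵥ v))) * c
      + u ⬝ᵥ (V *ᵥ u) := by
    intro c
    have := hV.dotProduct_mulVec_nonneg (u + c • v)
    simp only [star_trivial, Matrix.mulVec_add, Matrix.mulVec_smul, add_dotProduct,
      dotProduct_add, smul_dotProduct, dotProduct_smul, smul_eq_mul, hs] at this
    linarith
  have := discrim_le_zero h
  unfold discrim at this
  nlinarith

theorem weightedNorm_nonneg {d : ℕ} (V : Matrix (Fin d) (Fin d) ℝ)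
    (v : EuclideanSpace ℝ (Fin d)) : 0 ≤ weightedNorm V v := Real.sqrt_nonneg _

theorem weightedNorm_sq {d : ℕ} {V : Matrix (Fin d) (Fin d) ℝ} (hV : V.PosSemidef)
    (v : EuclideanSpace ℝ (Fin d)) : weightedNorm V v ^ 2 = v.ofLp ⬝ᵥ (V *ᵥ v.ofLp) :=
  Real.sq_sqrt (by simpa using hV.dotProduct_mulVec_nonneg v.ofLp)

theorem dotProduct_mulVec_le_weightedNorm_mul {d : ℕ} {V : Matrix (Fin d) (Fin d) ℝ}
    (hV : V.PosSemidef) (u v : EuclideanSpace ℝ (Fin d)) :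
    u.ofLp ⬝ᵥ (V *ᵥ v.ofLp) ≤ weightedNorm V u * weightedNorm V v := by
  have h := hV.sq_dotProduct_mulVec_le u.ofLp v.ofLp
  rw [← weightedNorm_sq hV, ← weightedNorm_sq hV, ← mul_pow] at h
  exact le_of_sq_le_sq h (mul_nonneg (weightedNorm_nonneg _ _) (weightedNorm_nonneg _ _))

theorem weightedNorm_sub_le {d : ℕ} {V : Matrix (Fin d) (Fin d) ℝ}
    (hV : V.PosSemidef) (u v : EuclideanSpace ℝ (Fin d)) :
    weightedNorm V (u - v) ≤ weightedNorm V u + weightedNorm V v := by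
  refine le_of_sq_le_sq ?_ (add_nonneg (weightedNorm_nonneg _ _) (weightedNorm_nonneg _ _))
  have h1 := hV.sq_dotProduct_mulVec_le u.ofLp v.ofLp
  have h2 := hV.sq_dotProduct_mulVec_le v.ofLp u.ofLp
  have hu := weightedNorm_nonneg V u
  have hv := weightedNorm_nonneg V v
  have hu' := weightedNorm_sq hV u
  have hv' := weightedNorm_sq hV v
  rw [← hu', ← hv', ← mul_pow] at h1
  rw [← hu', ← hv', ← mul_pow] at h2
  have h1 := abs_le_of_sq_le_sq h1 (by positivity)
  have h2 := abs_le_of_sq_le_sq h2 (by positivity)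
  rw [weightedNorm_sq hV]
  simp only [WithLp.ofLp_sub, Matrix.mulVec_sub, sub_dotProduct, dotProduct_sub]
  nlinarith [neg_abs_le (u.ofLp ⬝ᵥ (V *ᵥ v.ofLp)), neg_abs_le (v.ofLp ⬝ᵥ (V *ᵥ u.ofLp))]

theorem vecMulVec_mulVec_self {d : ℕ} (a v : EuclideanSpace ℝ (Fin d)) :
    Matrix.vecMulVec a.ofLp a.ofLp *ᵥ v.ofLp = (inner ℝ a v : ℝ) • a.ofLp := by
  rw [Matrix.vecMulVec_mulVec]
  ext i
  simp [PiLp.inner_apply, dotProduct, mul_comm]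

theorem designMatrix_mulVec {d : ℕ} (lam : ℝ) (x : ℕ → EuclideanSpace ℝ (Fin d)) (t : ℕ)
    (v : EuclideanSpace ℝ (Fin d)) :
    designMatrix lam x t *ᵥ v.ofLp =
      lam • v.ofLp + ∑ s ∈ Finset.range t, (inner ℝ (x s) v : ℝ) • (x s).ofLp := by
  simp only [designMatrix, Matrix.add_mulVec, Matrix.smul_mulVec, Matrix.one_mulVec,
    Matrix.sum_mulVec, vecMulVec_mulVec_self]

theorem dotProduct_eq_inner {d : ℕ} (u v : EuclideanSpace ℝ (Fin d)) :
    u.ofLp ⬝ᵥ v.ofLp = inner ℝ u v := by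
  simp [PiLp.inner_apply, dotProduct, mul_comm]

theorem dotProduct_designMatrix_mulVec {d : ℕ} (lam : ℝ) (x : ℕ → EuclideanSpace ℝ (Fin d))
    (t : ℕ) (v : EuclideanSpace ℝ (Fin d)) :
    v.ofLp ⬝ᵥ (designMatrix lam x t *ᵥ v.ofLp) =
      lam * ‖v‖ ^ 2 + ∑ s ∈ Finset.range t, (inner ℝ (x s) v : ℝ) ^ 2 := by
  rw [designMatrix_mulVec, dotProduct_add, dotProduct_smul, dotProduct_sum, dotProduct_eq_inner,
    real_inner_self_eq_norm_sq, smul_eq_mul]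
  congr 1
  refine Finset.sum_congr rfl fun s _ => ?_
  rw [dotProduct_smul, dotProduct_eq_inner, real_inner_comm, smul_eq_mul, sq]

theorem designMatrix_isHermitian {d : ℕ} (lam : ℝ) (x : ℕ → EuclideanSpace ℝ (Fin d)) (t : ℕ) :
    (designMatrix lam x t).IsHermitian := by
  simp [Matrix.IsHermitian, designMatrix, Matrix.transpose_sum, Matrix.transpose_vecMulVec]

theorem designMatrix_posDef {d : ℕ} {lam : ℝ} (hlam : 0 < lam)
    (x : ℕ → EuclideanSpace ℝ (Fin d)) (t : ℕ) : (designMatrix lam x t).PosDef := by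
  refine Matrix.PosDef.of_dotProduct_mulVec_pos (designMatrix_isHermitian lam x t) fun v hv => ?_
  have := dotProduct_designMatrix_mulVec lam x t (WithLp.toLp 2 v)
  simp only [star_trivial]
  simp only at this
  rw [this]
  have : 0 < ‖WithLp.toLp 2 v‖ := by simpa using hv
  have := Finset.sum_nonneg fun s (_ : s ∈ Finset.range t) =>
    sq_nonneg (inner ℝ (x s) (WithLp.toLp 2 v) : ℝ)
  positivity

/-- The solution `u` of `V_t u = b`. -/
noncomputable def designSolve {d : ℕ} (lam : ℝ) (x : ℕ → EuclideanSpace ℝ (Fin d)) (t : ℕ)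
    (b : EuclideanSpace ℝ (Fin d)) : EuclideanSpace ℝ (Fin d) :=
  WithLp.toLp 2 ((designMatrix lam x t)⁻¹ *ᵥ b.ofLp)

theorem designMatrix_mulVec_designSolve {d : ℕ} {lam : ℝ} (hlam : 0 < lam)
    (x : ℕ → EuclideanSpace ℝ (Fin d)) (t : ℕ) (b : EuclideanSpace ℝ (Fin d)) :
    designMatrix lam x t *ᵥ (designSolve lam x t b).ofLp = b.ofLp := by
  have hdet := (Matrix.isUnit_iff_isUnit_det _).1 (designMatrix_posDef hlam x t).isUnit
  rw [designSolve, Matrix.mulVec_mulVec, Matrix.mul_nonsing_inv _ hdet, Matrix.one_mulVec]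

theorem designSolve_mulVec {d : ℕ} {lam : ℝ} (hlam : 0 < lam)
    (x : ℕ → EuclideanSpace ℝ (Fin d)) (t : ℕ) (v : EuclideanSpace ℝ (Fin d)) :
    designSolve lam x t (WithLp.toLp 2 (designMatrix lam x t *ᵥ v.ofLp)) = v := by
  have hdet := (Matrix.isUnit_iff_isUnit_det _).1 (designMatrix_posDef hlam x t).isUnit
  rw [designSolve, Matrix.mulVec_mulVec, Matrix.nonsing_inv_mul _ hdet, Matrix.one_mulVec]

theorem weightedNorm_designSolve_sq {d : ℕ} {lam : ℝ} (hlam : 0 < lam)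
    (x : ℕ → EuclideanSpace ℝ (Fin d)) (t : ℕ) (b : EuclideanSpace ℝ (Fin d)) :
    weightedNorm (designMatrix lam x t) (designSolve lam x t b) ^ 2 =
      inner ℝ (designSolve lam x t b) b := by
  rw [weightedNorm_sq (designMatrix_posDef hlam x t).posSemidef,
    designMatrix_mulVec_designSolve hlam, dotProduct_eq_inner]

theorem inner_le_weightedNorm_mul {d : ℕ} {lam : ℝ} (hlam : 0 < lam)
    (x : ℕ → EuclideanSpace ℝ (Fin d)) (t : ℕ) (z b : EuclideanSpace ℝ (Fin d)) :
    inner ℝ z b ≤ weightedNorm (designMatrix lam x t) z *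
      weightedNorm (designMatrix lam x t) (designSolve lam x t b) := by
  have := dotProduct_mulVec_le_weightedNorm_mul (designMatrix_posDef hlam x t).posSemidef z
    (designSolve lam x t b)
  rwa [designMatrix_mulVec_designSolve hlam, dotProduct_eq_inner] at this

/-! ### The least squares error and the confidence ellipsoids. -/

/-- The accumulated noise `∑_{s < t} ε_s x_s`. -/
noncomputable def noiseSum {d : ℕ} (x : ℕ → EuclideanSpace ℝ (Fin d)) (ε : ℕ → ℝ) (t : ℕ) :
    EuclideanSpace ℝ (Fin d) := ∑ s ∈ Finset.range t, ε s • x s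

/-- Write `θ = V⁻¹(V θ)` and expand `V θ`: the signal part of the observations cancels, leaving the
noise term and the bias due to regularization. -/
theorem olsEstimator_sub_eq {d : ℕ} {lam : ℝ} (hlam : 0 < lam)
    (x : ℕ → EuclideanSpace ℝ (Fin d)) (ε : ℕ → ℝ) (θ : EuclideanSpace ℝ (Fin d)) (t : ℕ) :
    olsEstimator lam x (fun s => inner ℝ θ (x s) + ε s) t - θ =
      designSolve lam x t (noiseSum x ε t) - designSolve lam x t (lam • θ) := by
  have h := designSolve_mulVec hlam x t θ
  nth_rewrite 2 [← h]
  rw [designMatrix_mulVec]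
  apply WithLp.ofLp_injective
  simp only [olsEstimator, designSolve, WithLp.ofLp_sub, noiseSum, WithLp.ofLp_smul,
    ← Matrix.mulVec_sub]
  congr 1
  simp only [add_smul, Finset.sum_add_distrib, WithLp.ofLp_sum, WithLp.ofLp_smul]
  simp only [real_inner_comm θ]
  abel

/-- Since `V ≥ λ I`, the solution `u` of `V u = λθ` satisfies `‖u‖ ≤ ‖θ‖`, and `‖u‖_V² = λ⟨u, θ⟩`.
This is the bias that the summand `√λ B` of the radius pays for. -/
theorem weightedNorm_designSolve_smul_le {d : ℕ} {lam : ℝ} (hlam : 0 < lam)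
    (x : ℕ → EuclideanSpace ℝ (Fin d)) (t : ℕ) (θ : EuclideanSpace ℝ (Fin d)) :
    weightedNorm (designMatrix lam x t) (designSolve lam x t (lam • θ)) ≤ Real.sqrt lam * ‖θ‖ := by
  set u := designSolve lam x t (lam • θ) with hu
  have hV := (designMatrix_posDef hlam x t).posSemidef
  have h1 := weightedNorm_designSolve_sq hlam x t (lam • θ)
  have h2 := weightedNorm_sq hV u
  rw [dotProduct_designMatrix_mulVec] at h2
  rw [← hu, real_inner_smul_right] at h1
  have h3 := real_inner_le_norm u θ
  have h4 := Finset.sum_nonneg fun s (_ : s ∈ Finset.range t) =>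
    sq_nonneg (inner ℝ (x s) u : ℝ)
  refine le_of_sq_le_sq ?_ (by positivity)
  rw [mul_pow, Real.sq_sqrt hlam.le]
  have h5 : lam * ‖u‖ ^ 2 ≤ lam * (‖u‖ * ‖θ‖) := by nlinarith
  have h6 : ‖u‖ ≤ ‖θ‖ := by
    by_contra! hlt
    have := le_of_mul_le_mul_left h5 hlam
    nlinarith [norm_nonneg θ]
  nlinarith [norm_nonneg θ, mul_le_mul_of_nonneg_right h6 (norm_nonneg θ)]

/-- A parameter whose accumulated noise is small lies in the confidence ellipsoid. -/
theorem mem_confSet {d : ℕ} {B lam δ : ℝ} (hlam : 0 < lam)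
    {x : ℕ → EuclideanSpace ℝ (Fin d)} {ε : ℕ → ℝ} {θ : EuclideanSpace ℝ (Fin d)} {t : ℕ}
    (hθ : ‖θ‖ ≤ B)
    (h : inner ℝ (designSolve lam x t (noiseSum x ε t)) (noiseSum x ε t) ≤
      d * Real.log (1 + ((t : ℝ) * B ^ 2 / lam) / δ)) :
    θ ∈ confSet B lam δ x (fun s => inner ℝ θ (x s) + ε s) t := by
  have hV := (designMatrix_posDef hlam x t).posSemidef
  rw [confSet, Set.mem_ofPred_eq, olsEstimator_sub_eq hlam, confRadius]
  refine (weightedNorm_sub_le hV _ _).trans (add_le_add ?_ ?_)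
  · rw [← weightedNorm_designSolve_sq hlam] at h
    exact Real.le_sqrt_of_sq_le h
  · exact (weightedNorm_designSolve_smul_le hlam x t θ).trans
      (mul_le_mul_of_nonneg_left hθ (Real.sqrt_nonneg _))

/-- The width `‖x_t‖_{V_t⁻¹}` of the confidence ellipsoid in the direction played. -/
noncomputable def designWidth {d : ℕ} (lam : ℝ) (x : ℕ → EuclideanSpace ℝ (Fin d)) (t : ℕ) : ℝ :=
  weightedNorm (designMatrix lam x t) (designSolve lam x t (x t))

theorem inner_sub_le_of_mem_confSet {d : ℕ} {B lam δ : ℝ} (hlam : 0 < lam)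
    {x : ℕ → EuclideanSpace ℝ (Fin d)} {y : ℕ → ℝ} {t : ℕ} {θ θ' : EuclideanSpace ℝ (Fin d)}
    (hθ : θ ∈ confSet B lam δ x y t) (hθ' : θ' ∈ confSet B lam δ x y t) :
    inner ℝ (θ - θ') (x t) ≤ 2 * confRadius d B lam δ t * designWidth lam x t := by
  have hV := (designMatrix_posDef hlam x t).posSemidef
  refine (inner_le_weightedNorm_mul hlam x t _ _).trans ?_
  refine mul_le_mul_of_nonneg_right ?_ (weightedNorm_nonneg _ _)
  have h : θ - θ' = (olsEstimator lam x y t - θ') - (olsEstimator lam x y t - θ) := by abel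
  rw [h]
  refine (weightedNorm_sub_le hV _ _).trans ?_
  have h1 : weightedNorm _ _ ≤ _ := hθ
  have h2 : weightedNorm _ _ ≤ _ := hθ'
  linarith

/-! ### The elliptical potential. -/

/-- A round is a rank-one update, so the matrix determinant lemma applies; `log det V_t` then
telescopes into a sum of the widths. -/
theorem designMatrix_det_succ {d : ℕ} {lam : ℝ} (hlam : 0 < lam)
    (x : ℕ → EuclideanSpace ℝ (Fin d)) (t : ℕ) :
    (designMatrix lam x (t + 1)).det =
      (designMatrix lam x t).det * (1 + designWidth lam x t ^ 2) := by
  have hdet := (Matrix.isUnit_iff_isUnit_det _).1 (designMatrix_posDef hlam x t).isUnit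
  have h : designMatrix lam x (t + 1) = designMatrix lam x t +
      Matrix.replicateCol Unit (x t).ofLp * Matrix.replicateRow Unit (x t).ofLp := by
    rw [← Matrix.vecMulVec_eq, designMatrix, designMatrix, Finset.sum_range_succ, add_assoc]
  rw [h, Matrix.det_add_replicateCol_mul_replicateRow hdet, designWidth,
    weightedNorm_designSolve_sq hlam, ← dotProduct_eq_inner, designSolve]
  rw [Matrix.mul_assoc, ← Matrix.replicateCol_mulVec, Matrix.det_unique (n := Unit), Matrix.add_apply,
    Matrix.replicateRow_mul_replicateCol_apply, Matrix.one_apply_eq, dotProduct_comm]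

theorem min_one_le_two_mul_log {y : ℝ} (hy : 0 ≤ y) : min 1 y ≤ 2 * Real.log (1 + y) := by
  have h := Real.one_sub_inv_le_log_of_pos (show 0 < 1 + y by linarith)
  have : min 1 y ≤ 2 * (1 - (1 + y)⁻¹) := by
    have : 2 * (1 - (1 + y)⁻¹) = 2 * y / (1 + y) := by field_simp; ring
    rw [this, le_div_iff₀ (by linarith)]
    rcases le_total 1 y with h | h
    · rw [min_eq_left h]; linarith
    · rw [min_eq_right h]; nlinarith
  linarith

theorem dotProduct_designMatrix_mulVec_le {d : ℕ} {lam L : ℝ}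
    {x : ℕ → EuclideanSpace ℝ (Fin d)} {t : ℕ} (hx : ∀ s < t, ‖x s‖ ≤ L)
    (v : EuclideanSpace ℝ (Fin d)) :
    v.ofLp ⬝ᵥ (designMatrix lam x t *ᵥ v.ofLp) ≤ (lam + t * L ^ 2) * ‖v‖ ^ 2 := by
  rw [dotProduct_designMatrix_mulVec, add_mul]
  have : ∑ s ∈ Finset.range t, (inner ℝ (x s) v : ℝ) ^ 2 ≤
      ∑ s ∈ Finset.range t, L ^ 2 * ‖v‖ ^ 2 := by
    refine Finset.sum_le_sum fun s hs => ?_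
    rw [← mul_pow]
    have h1 := abs_real_inner_le_norm (x s) v
    have h2 := mul_le_mul_of_nonneg_right (hx s (Finset.mem_range.1 hs)) (norm_nonneg v)
    exact sq_le_sq' (by linarith [neg_abs_le (inner ℝ (x s) v : ℝ)])
      (by linarith [le_abs_self (inner ℝ (x s) v : ℝ)])
  rw [Finset.sum_const, Finset.card_range, nsmul_eq_mul] at this
  linarith

/-- Every eigenvalue is the quadratic form at a unit eigenvector, hence at most `λ + tL²`. -/
theorem designMatrix_det_le {d : ℕ} {lam L : ℝ} (hlam : 0 < lam)
    {x : ℕ → EuclideanSpace ℝ (Fin d)} {t : ℕ} (hx : ∀ s < t, ‖x s‖ ≤ L) :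
    (designMatrix lam x t).det ≤ (lam + t * L ^ 2) ^ d := by
  have hH := designMatrix_isHermitian lam x t
  have hP := designMatrix_posDef hlam x t
  rw [hH.det_eq_prod_eigenvalues]
  simp only [RCLike.ofReal_real_eq_id, id_eq]
  have : ∏ i, hH.eigenvalues i ≤ ∏ _i : Fin d, (lam + t * L ^ 2) := by
    refine Finset.prod_le_prod (fun i _ => (hP.eigenvalues_pos i).le) fun i _ => ?_
    rw [hH.eigenvalues_eq]
    have h := dotProduct_designMatrix_mulVec_le (lam := lam) hx (hH.eigenvectorBasis i)
    simpa using h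
  simpa using this

/-- The elliptical potential bound. -/
theorem sum_min_one_designWidth_sq_le {d : ℕ} {lam L : ℝ} (hlam : 0 < lam)
    {x : ℕ → EuclideanSpace ℝ (Fin d)} {T : ℕ} (hx : ∀ s < T, ‖x s‖ ≤ L) :
    ∑ t ∈ Finset.range T, min 1 (designWidth lam x t ^ 2) ≤
      2 * (d * Real.log (1 + T * L ^ 2 / lam)) := by
  have h : ∀ n, Real.log (designMatrix lam x n).det = d * Real.log lam +
      ∑ t ∈ Finset.range n, Real.log (1 + designWidth lam x t ^ 2) := by
    intro n
    induction n with
    | zero => simp [designMatrix, Real.log_pow]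
    | succ n ih =>
      rw [designMatrix_det_succ hlam, Real.log_mul (designMatrix_posDef hlam x n).det_pos.ne'
        (by positivity), ih, Finset.sum_range_succ, add_assoc]
  have hd := Real.log_le_log (designMatrix_posDef hlam x T).det_pos (designMatrix_det_le hlam hx)
  rw [h, Real.log_pow] at hd
  have he : lam + T * L ^ 2 = lam * (1 + T * L ^ 2 / lam) := by field_simp
  rw [he, Real.log_mul hlam.ne' (by positivity)] at hd
  have := Finset.sum_le_sum fun t (_ : t ∈ Finset.range T) =>
    min_one_le_two_mul_log (sq_nonneg (designWidth lam x t))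
  rw [← Finset.mul_sum] at this
  linarith

/-! ### Conditional sub-Gaussianity and exponential supermartingales. -/

section SubGaussian

open scoped ENNReal

variable {Ω : Type*} {ℋ : MeasurableSpace Ω} [mΩ : MeasurableSpace Ω] {μ : Measure Ω}

theorem CondSubGaussian.integrable {ε : Ω → ℝ}
    (hε : CondSubGaussian μ ℋ ε) (hεm : Measurable ε) : Integrable ε μ := by
  refine Integrable.mono' ((hε 1).1.add (hε (-1)).1) hεm.aestronglyMeasurable
    (Filter.Eventually.of_forall fun ω => ?_)
  simp only [Pi.add_apply, Real.norm_eq_abs]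
  have h1 := Real.add_one_le_exp (1 * ε ω)
  have h2 := Real.add_one_le_exp (-1 * ε ω)
  have h3 := Real.exp_pos (1 * ε ω)
  have h4 := Real.exp_pos (-1 * ε ω)
  exact abs_le.2 ⟨by linarith, by linarith⟩

variable [IsProbabilityMeasure μ]

/-- The conditional moment bound says that `μ` with density `exp(aε - a²/2)` is dominated by `μ` on
`ℋ`; the claim integrates `h` against both restrictions. Values in `ℝ≥0∞` make integrability of `h`
unnecessary. -/
theorem CondSubGaussian.lintegral_mul_exp_le (hm : ℋ ≤ mΩ) {ε : Ω → ℝ}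
    (hε : CondSubGaussian μ ℋ ε) (hεm : Measurable ε) {h : Ω → ℝ≥0∞} (hh : Measurable[ℋ] h)
    (a : ℝ) :
    ∫⁻ ω, h ω * ENNReal.ofReal (Real.exp (a * ε ω - a ^ 2 / 2)) ∂μ ≤ ∫⁻ ω, h ω ∂μ := by
  set φ : Ω → ℝ≥0∞ := fun ω => ENNReal.ofReal (Real.exp (a * ε ω - a ^ 2 / 2)) with hφ
  have hφm : Measurable φ := by fun_prop
  have hle : (μ.withDensity φ).trim hm ≤ μ.trim hm := by
    refine Measure.le_iff.2 fun s hs => ?_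
    rw [trim_measurableSet_eq hm hs, trim_measurableSet_eq hm hs, withDensity_apply _ (hm s hs)]
    obtain ⟨hint, hcond⟩ := hε a
    have h1 : ∫ ω in s, Real.exp (a * ε ω) ∂μ ≤ Real.exp (a ^ 2 / 2) * μ.real s := by
      rw [← setIntegral_condExp hm hint hs]
      have := setIntegral_mono_ae (s := s) integrable_condExp.integrableOn
        (integrable_const (Real.exp (a ^ 2 / 2))).integrableOn hcond
      simpa [mul_comm] using this
    have h2 : ∫ ω in s, Real.exp (a * ε ω - a ^ 2 / 2) ∂μ ≤ μ.real s := by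
      simp_rw [Real.exp_sub]
      rw [integral_div, div_le_iff₀ (Real.exp_pos _)]
      linarith
    rw [hφ, ← ofReal_integral_eq_lintegral_ofReal]
    · exact (ENNReal.ofReal_le_ofReal h2).trans_eq (by simp)
    · simp_rw [Real.exp_sub]
      exact (hint.div_const _).integrableOn
    · exact Filter.Eventually.of_forall fun _ => (Real.exp_pos _).le
  calc ∫⁻ ω, h ω * φ ω ∂μ = ∫⁻ ω, (φ * h) ω ∂μ := by simp only [Pi.mul_apply, mul_comm]
    _ = ∫⁻ ω, h ω ∂(μ.withDensity φ) :=
      (lintegral_withDensity_eq_lintegral_mul μ hφm (hh.mono hm le_rfl)).symm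
    _ = ∫⁻ ω, h ω ∂((μ.withDensity φ).trim hm) := (lintegral_trim hm hh).symm
    _ ≤ ∫⁻ ω, h ω ∂(μ.trim hm) := lintegral_mono' hle le_rfl
    _ = ∫⁻ ω, h ω ∂μ := lintegral_trim hm hh

theorem CondSubGaussian.lintegral_mul_exp_finite_range_le (hm : ℋ ≤ mΩ)
    {ε : Ω → ℝ} (hε : CondSubGaussian μ ℋ ε) (hεm : Measurable ε) {h : Ω → ℝ≥0∞}
    (hh : Measurable[ℋ] h) {a : Ω → ℝ} {R : Finset ℝ} (hR : ∀ ω, a ω ∈ R)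
    (hS : ∀ v, MeasurableSet[ℋ] (a ⁻¹' {v})) :
    ∫⁻ ω, h ω * ENNReal.ofReal (Real.exp (a ω * ε ω - (a ω) ^ 2 / 2)) ∂μ ≤ ∫⁻ ω, h ω ∂μ := by
  have key : ∀ ψ : Ω → ℝ≥0∞, ∀ ω,
      ψ ω = ∑ v ∈ R, (a ⁻¹' {v}).indicator ψ ω := by
    intro ψ ω
    rw [Finset.sum_eq_single_of_mem (a ω) (hR ω)]
    · simp
    · intro v _ hv
      simp [Set.indicator, hv.symm]
  have hm1 : ∀ v, Measurable[ℋ] ((a ⁻¹' {v}).indicator h) := fun v => hh.indicator (hS v)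
  calc ∫⁻ ω, h ω * ENNReal.ofReal (Real.exp (a ω * ε ω - (a ω) ^ 2 / 2)) ∂μ
      = ∫⁻ ω, ∑ v ∈ R, (a ⁻¹' {v}).indicator h ω *
          ENNReal.ofReal (Real.exp (v * ε ω - v ^ 2 / 2)) ∂μ := by
        refine lintegral_congr fun ω => ?_
        rw [Finset.sum_eq_single_of_mem (a ω) (hR ω)]
        · simp
        · intro v _ hv
          simp [Set.indicator, hv.symm]
    _ = ∑ v ∈ R, ∫⁻ ω, (a ⁻¹' {v}).indicator h ω *
          ENNReal.ofReal (Real.exp (v * ε ω - v ^ 2 / 2)) ∂μ := by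
        refine lintegral_finsetSum _ fun v _ => ?_
        exact ((hm1 v).mono hm le_rfl).mul (by fun_prop)
    _ ≤ ∑ v ∈ R, ∫⁻ ω, (a ⁻¹' {v}).indicator h ω ∂μ :=
        Finset.sum_le_sum fun v _ => hε.lintegral_mul_exp_le hm hεm (hm1 v) v
    _ = ∫⁻ ω, ∑ v ∈ R, (a ⁻¹' {v}).indicator h ω ∂μ :=
        (lintegral_finsetSum _ fun v _ => (hm1 v).mono hm le_rfl).symm
    _ = ∫⁻ ω, h ω ∂μ := lintegral_congr fun ω => (key h ω).symm

/-- Approximate the multiplier by `ℋ`-simple functions and apply Fatou; as only an upper bound is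
wanted, no domination is needed. -/
theorem CondSubGaussian.lintegral_mul_exp_predictable_le (hm : ℋ ≤ mΩ)
    {ε : Ω → ℝ} (hε : CondSubGaussian μ ℋ ε) (hεm : Measurable ε) {h : Ω → ℝ≥0∞}
    (hh : Measurable[ℋ] h) {a : Ω → ℝ} (ha : StronglyMeasurable[ℋ] a) :
    ∫⁻ ω, h ω * ENNReal.ofReal (Real.exp (a ω * ε ω - (a ω) ^ 2 / 2)) ∂μ ≤ ∫⁻ ω, h ω ∂μ := by
  let F : ℕ → Ω → ℝ≥0∞ := fun n ω =>
    h ω * ENNReal.ofReal (Real.exp (ha.approx n ω * ε ω - (ha.approx n ω) ^ 2 / 2))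
  have hF : ∀ ω, Filter.Tendsto (fun n => F n ω) Filter.atTop
      (nhds (h ω * ENNReal.ofReal (Real.exp (a ω * ε ω - (a ω) ^ 2 / 2)))) := by
    intro ω
    have h1 := ha.tendsto_approx ω
    -- `h ω` may be `∞`; the product still converges because the limit of the exponentials is
    -- nonzero.
    refine ENNReal.Tendsto.const_mul (ENNReal.tendsto_ofReal ?_) (Or.inl (by simp [Real.exp_pos]))
    exact (Real.continuous_exp.tendsto _).comp ((h1.mul_const _).sub ((h1.pow 2).div_const 2))
  have hFm : ∀ n, Measurable (F n) := fun n => by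
    have h1 : Measurable (ha.approx n) := (@SimpleFunc.measurable Ω ℝ ℋ _ (ha.approx n)).mono hm le_rfl
    have h2 : Measurable h := hh.mono hm le_rfl
    fun_prop
  calc _ = ∫⁻ ω, Filter.liminf (fun n => F n ω) Filter.atTop ∂μ :=
        lintegral_congr fun ω => ((hF ω).liminf_eq).symm
    _ ≤ Filter.liminf (fun n => ∫⁻ ω, F n ω ∂μ) Filter.atTop := lintegral_liminf_le hFm
    _ ≤ Filter.liminf (fun _ : ℕ => ∫⁻ ω, h ω ∂μ) Filter.atTop :=
        Filter.liminf_le_liminf (Filter.Eventually.of_forall fun n =>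
          hε.lintegral_mul_exp_finite_range_le hm hεm hh
            (R := @SimpleFunc.range Ω ℝ ℋ (ha.approx n))
            (fun ω => @SimpleFunc.mem_range_self Ω ℝ ℋ (ha.approx n) ω)
            (fun v => @SimpleFunc.measurableSet_fiber Ω ℝ ℋ (ha.approx n) v))
    _ = ∫⁻ ω, h ω ∂μ := by simp

/-- The exponential supermartingale of a predictable sequence `a` has expectation at most `1`. -/
theorem IsSubGaussianNoise.lintegral_exp_sum_le {ℱ : Filtration ℕ mΩ} {T : ℕ} {ε : ℕ → Ω → ℝ}
    (hε : IsSubGaussianNoise μ ℱ T ε) {a : ℕ → Ω → ℝ}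
    (ha : ∀ t < T, StronglyMeasurable[ℱ t] (a t)) {t : ℕ} (ht : t ≤ T) :
    ∫⁻ ω, ENNReal.ofReal (Real.exp (∑ s ∈ Finset.range t,
      (a s ω * ε s ω - (a s ω) ^ 2 / 2))) ∂μ ≤ 1 := by
  induction t with
  | zero => simp
  | succ t ih =>
    have htT : t < T := ht
    have hmeas : Measurable[ℱ t] fun ω => ENNReal.ofReal (Real.exp (∑ s ∈ Finset.range t,
        (a s ω * ε s ω - (a s ω) ^ 2 / 2))) := by
      refine ENNReal.measurable_ofReal.comp (Real.measurable_exp.comp ?_)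
      refine Finset.measurable_fun_sum _ fun s hs => ?_
      have hs := Finset.mem_range.1 hs
      have h1 : Measurable[ℱ t] (a s) :=
        (ha s (hs.trans htT)).measurable.mono (ℱ.mono hs.le) le_rfl
      have h2 : Measurable[ℱ t] (ε s) :=
        (hε s (hs.trans htT)).1.measurable.mono (ℱ.mono hs) le_rfl
      exact (h1.mul h2).sub ((h1.pow_const 2).div_const 2)
    refine le_trans (le_of_eq ?_) (((hε t htT).2.lintegral_mul_exp_predictable_le (ℱ.le t)
      ((hε t htT).1.measurable.mono (ℱ.le _) le_rfl) hmeas (ha t htT)).trans (ih htT.le))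
    refine lintegral_congr fun ω => ?_
    rw [Finset.sum_range_succ, Real.exp_add, ENNReal.ofReal_mul (Real.exp_pos _).le]

/-- A conditionally sub-Gaussian variable is centred. -/
theorem CondSubGaussian.integral_eq_zero (hm : ℋ ≤ mΩ) {ε : Ω → ℝ}
    (hε : CondSubGaussian μ ℋ ε) (hεm : Measurable ε) : ∫ ω, ε ω ∂μ = 0 := by
  have hint := hε.integrable hεm
  have key : ∀ a : ℝ, a * ∫ ω, ε ω ∂μ + 1 ≤ Real.exp (a ^ 2 / 2) := by
    intro a
    have h1 : ∫ ω, Real.exp (a * ε ω) ∂μ ≤ Real.exp (a ^ 2 / 2) := by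
      rw [← integral_condExp hm]
      have := integral_mono_ae integrable_condExp (integrable_const (Real.exp (a ^ 2 / 2)))
        (hε a).2
      simpa using this
    have h2 : ∫ ω, (a * ε ω + 1) ∂μ ≤ ∫ ω, Real.exp (a * ε ω) ∂μ :=
      integral_mono ((hint.const_mul a).add (integrable_const 1)) (hε a).1
        fun ω => Real.add_one_le_exp _
    rw [integral_add (hint.const_mul a) (integrable_const 1), integral_const_mul] at h2
    simp only [integral_const, probReal_univ, smul_eq_mul, mul_one] at h2
    linarith
  set c := ∫ ω, ε ω ∂μ
  -- The moment bound is quadratic at `a = 0`, so a nonzero linear term `a * c` is impossible: `a =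
  -- ±b` with `0 < b ≤ |c|/2` forces `|c| ≤ b`.
  have key2 : ∀ a : ℝ, |a| ≤ 1 → a * c ≤ a ^ 2 := by
    intro a ha
    have h1 : |a ^ 2 / 2| ≤ 1 := by
      rw [abs_of_nonneg (by positivity)]
      nlinarith [sq_abs a, abs_nonneg a]
    have h2 := abs_le.1 (Real.abs_exp_sub_one_le h1)
    rw [abs_of_nonneg (by positivity : 0 ≤ a ^ 2 / 2)] at h2
    linarith [key a]
  by_contra hc
  have hc' : 0 < |c| := abs_pos.2 hc
  set b := min 1 (|c| / 2) with hb
  have hb0 : 0 < b := lt_min one_pos (by linarith)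
  have hb1 : b ≤ 1 := min_le_left _ _
  have hb2 : b ≤ |c| / 2 := min_le_right _ _
  have h1 := key2 b (by rwa [abs_of_pos hb0])
  have h2 := key2 (-b) (by rwa [abs_neg, abs_of_pos hb0])
  have h3 : b * |c| ≤ b ^ 2 := by
    rcases abs_cases c with ⟨h, _⟩ | ⟨h, _⟩ <;> rw [h] <;> nlinarith
  have : |c| ≤ b := by nlinarith
  linarith

end SubGaussian

/-! ### Tail of the self-normalized noise by Gaussian mixtures. -/

/-- The self-normalized squared noise `‖∑_{s < t} ε_s x_s‖²` in the norm of `V_t⁻¹`. -/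
noncomputable def selfNormalizedNoise {d : ℕ} (lam : ℝ) (x : ℕ → EuclideanSpace ℝ (Fin d))
    (ε : ℕ → ℝ) (t : ℕ) : ℝ :=
  inner ℝ (designSolve lam x t (noiseSum x ε t)) (noiseSum x ε t)

theorem sum_inner_mul_sub_sq {d : ℕ} (x : ℕ → EuclideanSpace ℝ (Fin d)) (ε : ℕ → ℝ) (t : ℕ)
    (θ : EuclideanSpace ℝ (Fin d)) :
    ∑ s ∈ Finset.range t, ((inner ℝ (x s) θ : ℝ) * ε s - (inner ℝ (x s) θ : ℝ) ^ 2 / 2) =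
      inner ℝ θ (noiseSum x ε t) - (∑ s ∈ Finset.range t, (inner ℝ (x s) θ : ℝ) ^ 2) / 2 := by
  rw [Finset.sum_sub_distrib, Finset.sum_div, noiseSum, inner_sum]
  congr 1
  refine Finset.sum_congr rfl fun s _ => ?_
  rw [real_inner_smul_right, real_inner_comm, mul_comm]

/-- Completing the square: it turns `⟨θ, b⟩ - ‖θ‖_V²/2` at `θ = η + V⁻¹b` into `‖b‖²_{V⁻¹}/2 -
‖η‖_V²/2`. -/
theorem dotProduct_designMatrix_mulVec_add {d : ℕ} {lam : ℝ} (hlam : 0 < lam)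
    (x : ℕ → EuclideanSpace ℝ (Fin d)) (t : ℕ) (b η : EuclideanSpace ℝ (Fin d)) :
    (η + designSolve lam x t b).ofLp ⬝ᵥ
        (designMatrix lam x t *ᵥ (η + designSolve lam x t b).ofLp) =
      η.ofLp ⬝ᵥ (designMatrix lam x t *ᵥ η.ofLp) + 2 * inner ℝ η b +
        inner ℝ (designSolve lam x t b) b := by
  set u := designSolve lam x t b with hu
  have h := designMatrix_mulVec_designSolve hlam x t b
  have hs : u.ofLp ⬝ᵥ (designMatrix lam x t *ᵥ η.ofLp) = inner ℝ η b := by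
    have hT : (designMatrix lam x t)ᵀ = designMatrix lam x t := by
      simpa [Matrix.IsHermitian] using designMatrix_isHermitian lam x t
    rw [Matrix.dotProduct_mulVec, ← Matrix.mulVec_transpose, hT, hu, h, dotProduct_comm,
      dotProduct_eq_inner]
  rw [WithLp.ofLp_add, Matrix.mulVec_add, dotProduct_add, add_dotProduct, add_dotProduct, hs, h,
    dotProduct_eq_inner η b, dotProduct_eq_inner u b]
  ring

section Tail

open scoped ENNReal

theorem lintegral_exp_neg_mul_sq_norm {d : ℕ} {b : ℝ} (hb : 0 < b) :
    ∫⁻ v : EuclideanSpace ℝ (Fin d), ENNReal.ofReal (Real.exp (-b * ‖v‖ ^ 2)) =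
      ENNReal.ofReal ((Real.pi / b) ^ (d / 2 : ℝ)) := by
  have h := GaussianFourier.integral_rexp_neg_mul_sq_norm (V := EuclideanSpace ℝ (Fin d)) hb
  rw [finrank_euclideanSpace_fin] at h
  rw [← h, ofReal_integral_eq_lintegral_ofReal]
  -- A non-integrable function has integral zero, whereas the Gaussian integral is positive.
  · refine not_imp_comm.1 integral_undef ?_
    rw [h]
    have := Real.pi_pos
    positivity
  · exact Filter.Eventually.of_forall fun _ => (Real.exp_pos _).le

variable {Ω : Type*} [mΩ : MeasurableSpace Ω] {μ : Measure Ω} [IsProbabilityMeasure μ]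
  {ℱ : Filtration ℕ mΩ} {T d : ℕ} {ε : ℕ → Ω → ℝ} {x : ℕ → Ω → EuclideanSpace ℝ (Fin d)}

/-- The exponential supermartingale in direction `θ`. -/
theorem IsSubGaussianNoise.lintegral_exp_inner_le (hε : IsSubGaussianNoise μ ℱ T ε)
    (hx : ∀ t < T, StronglyMeasurable[ℱ t] (x t)) {t : ℕ} (ht : t ≤ T)
    (θ : EuclideanSpace ℝ (Fin d)) :
    ∫⁻ ω, ENNReal.ofReal (Real.exp (inner ℝ θ (noiseSum (fun s => x s ω) (fun s => ε s ω) t) -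
      (∑ s ∈ Finset.range t, (inner ℝ (x s ω) θ : ℝ) ^ 2) / 2)) ∂μ ≤ 1 := by
  have h := hε.lintegral_exp_sum_le (a := fun s ω => inner ℝ (x s ω) θ)
    (fun t ht => (hx t ht).inner stronglyMeasurable_const) ht
  refine le_trans (le_of_eq (lintegral_congr fun ω => ?_)) h
  rw [← sum_inner_mul_sub_sq (fun s => x s ω) (fun s => ε s ω) t θ]

/-- Pointwise tail bound for the self-normalized noise, by the method of Gaussian mixtures. -/
theorem IsSubGaussianNoise.measure_selfNormalizedNoise_ge_le (hε : IsSubGaussianNoise μ ℱ T ε)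
    (hx : ∀ t < T, StronglyMeasurable[ℱ t] (x t)) {t : ℕ} (ht : t ≤ T) {lam L : ℝ}
    (hlam : 0 < lam) (hL : ∀ s < t, ∀ ω, ‖x s ω‖ ≤ L) (c : ℝ) :
    μ.real {ω | c ≤ selfNormalizedNoise lam (fun s => x s ω) (fun s => ε s ω) t} ≤
      (1 + t * L ^ 2 / lam) ^ (d / 2 : ℝ) * Real.exp (-(c / 2)) := by
  set S : Ω → EuclideanSpace ℝ (Fin d) :=
    fun ω => noiseSum (fun s => x s ω) (fun s => ε s ω) t with hS
  -- The exponential process times an unnormalized Gaussian weight of precision `λ`, so that the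
  -- exponent is `⟨θ, S⟩ - ‖θ‖_V²/2` with the full design matrix.
  let F : Ω → EuclideanSpace ℝ (Fin d) → ℝ≥0∞ := fun ω θ =>
    ENNReal.ofReal (Real.exp (inner ℝ θ (S ω) -
      (∑ s ∈ Finset.range t, (inner ℝ (x s ω) θ : ℝ) ^ 2) / 2 - lam / 2 * ‖θ‖ ^ 2))
  have hxm : ∀ s < t, Measurable (x s) := fun s hs =>
    (hx s (hs.trans_le ht)).measurable.mono (ℱ.le s) le_rfl
  have hεm : ∀ s < t, Measurable (ε s) := fun s hs =>
    (hε s (hs.trans_le ht)).1.measurable.mono (ℱ.le _) le_rfl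
  have hFm : Measurable (Function.uncurry F) := by
    have h1 : Measurable S := by
      refine Finset.measurable_fun_sum _ fun s hs => ?_
      have hs := Finset.mem_range.1 hs
      exact (hεm s hs).smul (hxm s hs)
    have h2 : Measurable fun p : Ω × EuclideanSpace ℝ (Fin d) =>
        ∑ s ∈ Finset.range t, (inner ℝ (x s p.1) p.2 : ℝ) ^ 2 := by
      refine Finset.measurable_fun_sum _ fun s hs => ?_
      have := hxm s (Finset.mem_range.1 hs)
      exact ((this.comp measurable_fst).inner measurable_snd).pow_const 2
    have h3 : Measurable fun p : Ω × EuclideanSpace ℝ (Fin d) => (inner ℝ p.2 (S p.1) : ℝ) :=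
      measurable_snd.inner (h1.comp measurable_fst)
    exact ENNReal.measurable_ofReal.comp (Real.measurable_exp.comp
      ((h3.sub (h2.div_const 2)).sub ((measurable_snd.norm.pow_const 2).const_mul _)))
  -- By Tonelli, the supermartingale bound in each direction leaves only the integral of the weight.
  have hup : ∫⁻ ω, ∫⁻ θ, F ω θ ∂volume ∂μ ≤
      ENNReal.ofReal ((Real.pi / (lam / 2)) ^ (d / 2 : ℝ)) := by
    rw [lintegral_lintegral_swap hFm.aemeasurable,
      ← lintegral_exp_neg_mul_sq_norm (by positivity)]
    refine lintegral_mono fun θ => ?_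
    have h := hε.lintegral_exp_inner_le hx ht θ
    have : ∀ ω, F ω θ = ENNReal.ofReal (Real.exp (-(lam / 2) * ‖θ‖ ^ 2)) *
        ENNReal.ofReal (Real.exp (inner ℝ θ (S ω) -
          (∑ s ∈ Finset.range t, (inner ℝ (x s ω) θ : ℝ) ^ 2) / 2)) := by
      intro ω
      rw [← ENNReal.ofReal_mul (Real.exp_pos _).le, ← Real.exp_add]
      simp only [F]
      congr 2
      ring
    simp only [this]
    rw [lintegral_const_mul' _ _ (by simp)]
    exact mul_le_of_le_one_right' h
  -- Translation by `V⁻¹S` completes the square, and `V ≤ (λ + tL²) I` leaves a Gaussian integral.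
  -- The ratio of the two Gaussian integrals is the prefactor of the tail bound.
  have hlow : ∀ ω, ENNReal.ofReal (Real.exp
      (selfNormalizedNoise lam (fun s => x s ω) (fun s => ε s ω) t / 2)) *
      ENNReal.ofReal ((Real.pi / ((lam + t * L ^ 2) / 2)) ^ (d / 2 : ℝ)) ≤ ∫⁻ θ, F ω θ := by
    intro ω
    rw [← lintegral_exp_neg_mul_sq_norm (by positivity),
      ← lintegral_const_mul' _ _ (by simp),
      ← lintegral_add_right_eq_self (F ω) (designSolve lam (fun s => x s ω) t (S ω))]
    refine lintegral_mono fun η => ?_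
    rw [← ENNReal.ofReal_mul (Real.exp_pos _).le, ← Real.exp_add]
    refine ENNReal.ofReal_le_ofReal (Real.exp_le_exp.2 ?_)
    have h1 := dotProduct_designMatrix_mulVec_add hlam (fun s => x s ω) t (S ω) η
    rw [dotProduct_designMatrix_mulVec] at h1
    have h2 := dotProduct_designMatrix_mulVec_le (lam := lam) (fun s hs => hL s hs ω) η
    have hQ : selfNormalizedNoise lam (fun s => x s ω) (fun s => ε s ω) t =
        inner ℝ (designSolve lam (fun s => x s ω) t (S ω)) (S ω) := rfl
    rw [hQ, inner_add_left]
    linarith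
  have hb : (Real.pi / (lam / 2)) ^ (d / 2 : ℝ) = (1 + t * L ^ 2 / lam) ^ (d / 2 : ℝ) *
      (Real.pi / ((lam + t * L ^ 2) / 2)) ^ (d / 2 : ℝ) := by
    have := Real.pi_pos
    rw [← Real.mul_rpow (by positivity) (by positivity)]
    congr 1
    have : lam + t * L ^ 2 ≠ 0 := by positivity
    field_simp
  set G := (Real.pi / ((lam + t * L ^ 2) / 2)) ^ (d / 2 : ℝ) with hG
  have hGpos : 0 < G := by have := Real.pi_pos; positivity
  have hmk := mul_meas_ge_le_lintegral (μ := μ)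
    (hFm.lintegral_prod_right' (ν := volume))
    (ENNReal.ofReal (Real.exp (c / 2) * G))
  have hsub : {ω | c ≤ selfNormalizedNoise lam (fun s => x s ω) (fun s => ε s ω) t} ⊆
      {ω | ENNReal.ofReal (Real.exp (c / 2) * G) ≤ ∫⁻ θ, Function.uncurry F (ω, θ)} := by
    intro ω hω
    have hω : c ≤ selfNormalizedNoise lam (fun s => x s ω) (fun s => ε s ω) t := hω
    refine le_trans ?_ (hlow ω)
    rw [← ENNReal.ofReal_mul (Real.exp_pos _).le]
    exact ENNReal.ofReal_le_ofReal (by gcongr)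
  have hfin : ENNReal.ofReal (Real.exp (c / 2) * G) *
      μ {ω | c ≤ selfNormalizedNoise lam (fun s => x s ω) (fun s => ε s ω) t} ≤
      ENNReal.ofReal ((1 + t * L ^ 2 / lam) ^ (d / 2 : ℝ) * G) := by
    rw [← hb]
    exact (mul_le_mul_right (measure_mono hsub) _).trans (hmk.trans hup)
  have hr := ENNReal.toReal_mono ENNReal.ofReal_ne_top hfin
  rw [ENNReal.toReal_mul, ENNReal.toReal_ofReal (by positivity),
    ENNReal.toReal_ofReal (by positivity)] at hr
  rw [Real.exp_neg, ← div_eq_mul_inv, le_div_iff₀ (Real.exp_pos _)]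
  refine le_of_mul_le_mul_right ?_ hGpos
  rw [Measure.real]
  linarith

end Tail

/-! ### Tail of the self-normalized noise in dimension one. -/

/-- Some point of the geometric grid nearly maximizes `a ↦ a s - a² (v - lam) / 2`. -/
theorem exists_grid_point {lam v R s ℓ : ℝ} (hlam : 0 < lam) (hv : lam ≤ v)
    (hR : v ≤ lam * R ^ 2) (hR1 : 1 ≤ R) (hℓ : 0 < ℓ) (hs : ℓ * v ≤ s ^ 2) :
    ∃ j ∈ Finset.range (⌊(Real.sqrt ℓ + 1) * Real.log R⌋₊ + 1), ∃ σ ∈ ({1, -1} : Finset ℝ),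
      (ℓ - 1) / 2 ≤ (σ * (Real.sqrt ℓ / Real.sqrt lam / (1 + 1 / Real.sqrt ℓ) ^ j)) * s -
        (σ * (Real.sqrt ℓ / Real.sqrt lam / (1 + 1 / Real.sqrt ℓ) ^ j)) ^ 2 * (v - lam) / 2 := by
  set r := Real.sqrt ℓ with hr
  have hr0 : 0 < r := Real.sqrt_pos.2 hℓ
  have hr2 : r ^ 2 = ℓ := Real.sq_sqrt hℓ.le
  set w := Real.sqrt v with hw
  have hv0 : 0 < v := hlam.trans_le hv
  have hw0 : 0 < w := Real.sqrt_pos.2 hv0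
  have hw2 : w ^ 2 = v := Real.sq_sqrt hv0.le
  set l := Real.sqrt lam with hl
  have hl0 : 0 < l := Real.sqrt_pos.2 hlam
  have hl2 : l ^ 2 = lam := Real.sq_sqrt hlam.le
  set q := 1 + 1 / r with hq
  have hq1 : 1 < q := by rw [hq]; linarith [one_div_pos.2 hr0]
  have hlw : l ≤ w := Real.sqrt_le_sqrt hv
  -- With `r = √ℓ`, `w = √v` and grid ratio `q = 1 + 1/r`, this `j` puts `a w` between `r` and `r q
  -- = r + 1`.
  obtain ⟨j, hj1, hj2⟩ := exists_nat_pow_near ((one_le_div hl0).2 hlw) hq1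
  have hqj : 0 < q ^ j := by positivity
  have hwR : w / l ≤ R := by
    rw [div_le_iff₀ hl0]
    refine le_of_sq_le_sq ?_ (by positivity)
    rw [hw2, mul_pow, hl2]; linarith
  refine ⟨j, ?_, ?_⟩
  · rw [Finset.mem_range, Nat.lt_succ_iff]
    refine Nat.le_floor ?_
    have h1 := Real.log_le_log hqj (hj1.trans hwR)
    rw [Real.log_pow] at h1
    have h2 := Real.one_sub_inv_le_log_of_pos (show 0 < q by linarith)
    have h3 : 1 - q⁻¹ = 1 / (r + 1) := by rw [hq]; field_simp; ring
    rw [h3] at h2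
    have h4 : (j : ℝ) * (1 / (r + 1)) ≤ Real.log R :=
      (mul_le_mul_of_nonneg_left h2 (Nat.cast_nonneg j)).trans h1
    rw [mul_one_div, div_le_iff₀ (by positivity)] at h4
    linarith
  · set a := r / l / q ^ j with ha
    have ha0 : 0 < a := by positivity
    have haw : r ≤ a * w := by
      rw [ha, div_mul_eq_mul_div, le_div_iff₀ hqj, div_mul_eq_mul_div, mul_div_assoc]
      exact mul_le_mul_of_nonneg_left hj1 hr0.le
    have haw2 : a * w ≤ r + 1 := by
      have h1 : r * q = r + 1 := by rw [hq]; field_simp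
      rw [← h1, ha, div_mul_eq_mul_div, div_le_iff₀ hqj, div_mul_eq_mul_div, mul_div_assoc,
        mul_assoc, ← pow_succ']
      exact mul_le_mul_of_nonneg_left hj2.le hr0.le
    have hsabs : r * w ≤ |s| := by
      refine le_of_sq_le_sq ?_ (abs_nonneg s)
      rw [mul_pow, hr2, hw2, sq_abs]; exact hs
    -- The right side is at least `r (a w) - (a w)²/2 = (r² - (a w - r)²)/2`, so missing the optimal
    -- `a w = r` by at most one costs at most `1/2`.
    have hmain : (ℓ - 1) / 2 ≤ a * |s| - a ^ 2 * (v - lam) / 2 := by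
      have h1 : a * (r * w) ≤ a * |s| := mul_le_mul_of_nonneg_left hsabs ha0.le
      have h2 : 0 ≤ a ^ 2 * lam := by positivity
      rw [← hw2, ← hr2]
      nlinarith [mul_nonneg (sub_nonneg.2 haw) (sub_nonneg.2 haw2)]
    rcases abs_cases s with ⟨h, _⟩ | ⟨h, _⟩
    · refine ⟨1, by simp, ?_⟩
      rw [h] at hmain; simpa using hmain
    · refine ⟨-1, by simp, ?_⟩
      rw [h] at hmain
      linarith [hmain, show (-1 * a) * s - (-1 * a) ^ 2 * (v - lam) / 2 =
        a * -s - a ^ 2 * (v - lam) / 2 by ring]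

theorem selfNormalizedNoise_one_mul {lam : ℝ} (hlam : 0 < lam)
    (x : ℕ → EuclideanSpace ℝ (Fin 1)) (ε : ℕ → ℝ) (t : ℕ) :
    selfNormalizedNoise lam x ε t * (lam + ∑ s ∈ Finset.range t, (x s 0) ^ 2) =
      (noiseSum x ε t 0) ^ 2 := by
  have h := designMatrix_mulVec_designSolve hlam x t (noiseSum x ε t)
  rw [designMatrix_mulVec] at h
  have h0 := congrFun h 0
  simp only [Pi.add_apply, Pi.smul_apply, smul_eq_mul, Finset.sum_apply, PiLp.inner_apply,
    Fin.sum_univ_one, RCLike.inner_apply, conj_trivial] at h0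
  simp only [selfNormalizedNoise, PiLp.inner_apply, Fin.sum_univ_one, RCLike.inner_apply,
    conj_trivial]
  set u := designSolve lam x t (noiseSum x ε t) 0
  have h1 : u * (lam + ∑ s ∈ Finset.range t, (x s 0) ^ 2) = noiseSum x ε t 0 := by
    rw [← h0, mul_add, Finset.mul_sum, mul_comm u lam]
    congr 1
    exact Finset.sum_congr rfl fun s _ => by ring
  linear_combination noiseSum x ε t 0 * h1

section TailOne

variable {Ω : Type*} [mΩ : MeasurableSpace Ω] {μ : Measure Ω} [IsProbabilityMeasure μ]
  {ℱ : Filtration ℕ mΩ} {T : ℕ} {ε : ℕ → Ω → ℝ} {x : ℕ → Ω → EuclideanSpace ℝ (Fin 1)}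

/-- In dimension one a union bound over a geometric grid costs only logarithmic factors. -/
theorem IsSubGaussianNoise.measure_selfNormalizedNoise_one_ge_le
    (hε : IsSubGaussianNoise μ ℱ T ε)
    (hx : ∀ t < T, StronglyMeasurable[ℱ t] (x t)) {t : ℕ} (ht : t ≤ T) {lam L R ℓ : ℝ}
    (hlam : 0 < lam) (hL : ∀ s < t, ∀ ω, ‖x s ω‖ ≤ L) (hR1 : 1 ≤ R)
    (hR : lam + t * L ^ 2 ≤ lam * R ^ 2) (hℓ : 0 < ℓ) :
    μ.real {ω | ℓ ≤ selfNormalizedNoise lam (fun s => x s ω) (fun s => ε s ω) t} ≤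
      2 * ((Real.sqrt ℓ + 1) * Real.log R + 1) * Real.exp ((1 - ℓ) / 2) := by
  set N := ⌊(Real.sqrt ℓ + 1) * Real.log R⌋₊ + 1 with hN
  set a : ℕ → ℝ → ℝ := fun j σ =>
    σ * (Real.sqrt ℓ / Real.sqrt lam / (1 + 1 / Real.sqrt ℓ) ^ j) with ha
  let E : ℝ → Ω → ℝ := fun b ω => b * (noiseSum (fun s => x s ω) (fun s => ε s ω) t 0) -
    b ^ 2 * (∑ s ∈ Finset.range t, (x s ω 0) ^ 2) / 2
  have hE : ∀ b, ∫⁻ ω, ENNReal.ofReal (Real.exp (E b ω)) ∂μ ≤ 1 := by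
    intro b
    refine le_trans (le_of_eq (lintegral_congr fun ω => ?_))
      (hε.lintegral_exp_inner_le hx ht (EuclideanSpace.single 0 b))
    simp only [E, EuclideanSpace.inner_single_left, EuclideanSpace.inner_single_right,
      conj_trivial, mul_pow, Finset.mul_sum]
  have hEm : ∀ b, Measurable fun ω => ENNReal.ofReal (Real.exp (E b ω)) := by
    intro b
    refine ENNReal.measurable_ofReal.comp (Real.measurable_exp.comp ?_)
    have hxm : ∀ s < t, Measurable (x s) := fun s hs =>
      (hx s (hs.trans_le ht)).measurable.mono (ℱ.le s) le_rfl
    have hεm : ∀ s < t, Measurable (ε s) := fun s hs =>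
      (hε s (hs.trans_le ht)).1.measurable.mono (ℱ.le _) le_rfl
    have hp : Measurable fun y : EuclideanSpace ℝ (Fin 1) => y 0 := by fun_prop
    refine Measurable.sub (Measurable.const_mul (hp.comp ?_) _)
      (Measurable.div_const (Measurable.const_mul ?_ _) _)
    · refine Finset.measurable_fun_sum _ fun s hs => ?_
      have hs := Finset.mem_range.1 hs
      exact (hεm s hs).smul (hxm s hs)
    · refine Finset.measurable_fun_sum _ fun s hs => ?_
      exact (hp.comp (hxm s (Finset.mem_range.1 hs))).pow_const 2
  have hmk : ∀ b, μ.real {ω | (ℓ - 1) / 2 ≤ E b ω} ≤ Real.exp ((1 - ℓ) / 2) := by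
    intro b
    have h1 := (mul_meas_ge_le_lintegral (μ := μ) (hEm b)
      (ENNReal.ofReal (Real.exp ((ℓ - 1) / 2)))).trans (hE b)
    have h2 : {ω | (ℓ - 1) / 2 ≤ E b ω} ⊆
        {ω | ENNReal.ofReal (Real.exp ((ℓ - 1) / 2)) ≤ ENNReal.ofReal (Real.exp (E b ω))} :=
      fun ω hω => ENNReal.ofReal_le_ofReal (Real.exp_le_exp.2 hω)
    have h3 := ENNReal.toReal_mono ENNReal.one_ne_top
      ((mul_le_mul_right (measure_mono h2) _).trans h1)
    rw [ENNReal.toReal_mul, ENNReal.toReal_ofReal (Real.exp_pos _).le, ENNReal.toReal_one] at h3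
    have h4 : Real.exp ((1 - ℓ) / 2) = (Real.exp ((ℓ - 1) / 2))⁻¹ := by
      rw [← Real.exp_neg]; congr 1; ring
    rw [h4, ← one_div, le_div_iff₀ (Real.exp_pos _), mul_comm]
    exact h3
  have hsub : {ω | ℓ ≤ selfNormalizedNoise lam (fun s => x s ω) (fun s => ε s ω) t} ⊆
      ⋃ p ∈ Finset.range N ×ˢ ({1, -1} : Finset ℝ), {ω | (ℓ - 1) / 2 ≤ E (a p.1 p.2) ω} := by
    intro ω hω
    have hω : ℓ ≤ selfNormalizedNoise lam (fun s => x s ω) (fun s => ε s ω) t := hω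
    have hA := Finset.sum_nonneg fun s (_ : s ∈ Finset.range t) => sq_nonneg (x s ω 0)
    have hAle : ∑ s ∈ Finset.range t, (x s ω 0) ^ 2 ≤ t * L ^ 2 := by
      have : ∑ s ∈ Finset.range t, (x s ω 0) ^ 2 ≤ ∑ s ∈ Finset.range t, L ^ 2 := by
        refine Finset.sum_le_sum fun s hs => ?_
        rw [← sq_abs]
        exact pow_le_pow_left₀ (abs_nonneg _) ((PiLp.norm_apply_le (x s ω) 0).trans
          (hL s (Finset.mem_range.1 hs) ω)) 2
      simpa using this
    obtain ⟨j, hj, σ, hσ, h⟩ := exists_grid_point (lam := lam)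
      (v := lam + ∑ s ∈ Finset.range t, (x s ω 0) ^ 2) (R := R) (ℓ := ℓ)
      (s := noiseSum (fun s => x s ω) (fun s => ε s ω) t 0) hlam (by linarith) (by linarith)
      hR1 hℓ (by
        rw [← selfNormalizedNoise_one_mul hlam]
        exact mul_le_mul_of_nonneg_right hω (by positivity))
    simp only [Set.mem_iUnion]
    refine ⟨(j, σ), Finset.mem_product.2 ⟨hj, hσ⟩, ?_⟩
    rw [add_sub_cancel_left] at h
    exact h
  calc _ ≤ μ.real (⋃ p ∈ Finset.range N ×ˢ ({1, -1} : Finset ℝ),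
        {ω | (ℓ - 1) / 2 ≤ E (a p.1 p.2) ω}) := measureReal_mono hsub (measure_ne_top _ _)
    _ ≤ ∑ p ∈ Finset.range N ×ˢ ({1, -1} : Finset ℝ),
        μ.real {ω | (ℓ - 1) / 2 ≤ E (a p.1 p.2) ω} := measureReal_biUnion_finset_le _ _
    _ ≤ ∑ p ∈ Finset.range N ×ˢ ({1, -1} : Finset ℝ), Real.exp ((1 - ℓ) / 2) :=
        Finset.sum_le_sum fun p _ => hmk _
    _ ≤ _ := by
        rw [Finset.sum_const, Finset.card_product, Finset.card_range, nsmul_eq_mul]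
        refine mul_le_mul_of_nonneg_right ?_ (Real.exp_pos _).le
        have h2 : ({1, -1} : Finset ℝ).card = 2 := Finset.card_pair (by norm_num)
        have h3 := Nat.floor_le (a := (Real.sqrt ℓ + 1) * Real.log R)
          (mul_nonneg (by positivity) (Real.log_nonneg hR1))
        rw [h2, hN]
        push_cast
        linarith

end TailOne

/-! ### The expected number of failing rounds. -/

theorem one_half_le_log_one_add {T : ℕ} (hT : 1 ≤ T) : 1 / 2 ≤ Real.log (1 + T) := by
  have h1 : (1 : ℝ) ≤ T := by exact_mod_cast hT
  have h2 := Real.log_le_log (by norm_num) (show (2 : ℝ) ≤ 1 + T by linarith)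
  linarith [Real.log_two_gt_d9]

/-- A constant with `log (1 + c T²) ≤ logFactor c * log (1 + T)`. -/
noncomputable def logFactor (c : ℝ) : ℝ := 2 * Real.log (1 + c) + 2

theorem two_le_logFactor {c : ℝ} (hc : 0 ≤ c) : 2 ≤ logFactor c := by
  have := Real.log_nonneg (show 1 ≤ 1 + c by linarith)
  unfold logFactor
  linarith

theorem log_one_add_mul_sq_le {c : ℝ} (hc : 0 ≤ c) {T : ℕ} (hT : 1 ≤ T) :
    Real.log (1 + c * (T : ℝ) ^ 2) ≤ logFactor c * Real.log (1 + T) := by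
  have h1 : (1 : ℝ) ≤ T := by exact_mod_cast hT
  have h2 : 1 + c * (T : ℝ) ^ 2 ≤ (1 + c) * (1 + T) ^ 2 := by nlinarith
  have h3 := Real.log_le_log (by positivity) h2
  rw [Real.log_mul (by positivity) (by positivity), Real.log_pow] at h3
  have h4 := Real.log_nonneg (show 1 ≤ 1 + c by linarith)
  have h5 := one_half_le_log_one_add hT
  unfold logFactor
  push_cast at h3
  nlinarith

/-- Telescoping of `1/√(n+1) ≤ 2(√(n+1) - √n)`; the term `t = 0` is zero by the convention for
division. -/
theorem sum_one_div_sqrt_le (n : ℕ) :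
    ∑ t ∈ Finset.range (n + 1), 1 / Real.sqrt t ≤ 2 * Real.sqrt n := by
  induction n with
  | zero => simp
  | succ n ih =>
    rw [Finset.sum_range_succ]
    have h1 : Real.sqrt n ^ 2 = n := Real.sq_sqrt (Nat.cast_nonneg n)
    have h2 : Real.sqrt ((n + 1 : ℕ) : ℝ) ^ 2 = n + 1 := by
      rw [Real.sq_sqrt (Nat.cast_nonneg _)]; push_cast; ring
    have h3 : 0 < Real.sqrt ((n + 1 : ℕ) : ℝ) := Real.sqrt_pos.2 (by positivity)
    have h4 : 1 / Real.sqrt ((n + 1 : ℕ) : ℝ) ≤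
        2 * (Real.sqrt ((n + 1 : ℕ) : ℝ) - Real.sqrt n) := by
      rw [div_le_iff₀ h3]
      nlinarith [sq_nonneg (Real.sqrt ((n + 1 : ℕ) : ℝ) - Real.sqrt n)]
    linarith

theorem exp_one_sub_log_div_two_le {lam lam₁ t T : ℝ} (hlam : 0 < lam) (hlam₁ : lam ≤ lam₁)
    (ht : 1 ≤ t) (hT : 0 < T) :
    Real.exp ((1 - Real.log (1 + t * T / lam)) / 2) ≤
      Real.exp (1 / 2) * (Real.sqrt lam₁ / (Real.sqrt T * Real.sqrt t)) := by
  have ht0 : 0 < t := by linarith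
  have hl1 : 0 < lam₁ := hlam.trans_le hlam₁
  set b := 1 + t * T / lam with hb
  have hb0 : 0 < b := by positivity
  rw [show (1 - Real.log b) / 2 = 1 / 2 + -Real.log b / 2 by ring, Real.exp_add]
  refine mul_le_mul_of_nonneg_left ?_ (Real.exp_pos _).le
  rw [← Real.sqrt_mul hT.le, ← Real.sqrt_div' _ (by positivity)]
  refine Real.le_sqrt_of_sq_le ?_
  rw [← Real.exp_nat_mul]
  have : ((2 : ℕ) : ℝ) * (-Real.log b / 2) = -Real.log b := by push_cast; ring
  rw [this, Real.exp_neg, Real.exp_log hb0, inv_eq_one_div,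
    div_le_div_iff₀ hb0 (by positivity)]
  have h1 : b * lam = lam + t * T := by rw [hb]; field_simp
  have h2 : b * lam ≤ b * lam₁ := mul_le_mul_of_nonneg_left hlam₁ hb0.le
  linarith

theorem sqrt_le_one_add {y : ℝ} (hy : 0 ≤ y) : Real.sqrt y ≤ 1 + y :=
  Real.sqrt_le_iff.2 ⟨by linarith, by nlinarith⟩

theorem two_mul_gridSize_le {r ℓ ρ c1 c2 Λ : ℝ} (hr0 : 0 ≤ r) (hr : r ≤ 1 + ℓ) (hℓ : ℓ ≤ c2 * Λ)
    (hρ0 : 0 ≤ ρ) (hρ : ρ ≤ c1 * Λ / 2) (hΛ : 1 / 2 ≤ Λ) :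
    2 * ((r + 1) * ρ + 1) ≤ 2 * ((4 + c2) * c1 / 2 + 4) * Λ ^ 2 := by
  have h1 : r + 1 ≤ (4 + c2) * Λ := by linarith
  have h2 : (r + 1) * ρ ≤ ((4 + c2) * Λ) * (c1 * Λ / 2) :=
    mul_le_mul h1 hρ hρ0 (by linarith)
  have h3 : 1 ≤ 4 * Λ ^ 2 := by nlinarith
  linarith

theorem selfNormalizedNoise_zero {d : ℕ} (lam : ℝ) (x : ℕ → EuclideanSpace ℝ (Fin d))
    (ε : ℕ → ℝ) : selfNormalizedNoise lam x ε 0 = 0 := by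
  simp [selfNormalizedNoise, noiseSum]

/-- The event that the confidence ellipsoid of round `t` may miss the true parameter. -/
def failureSet {Ω : Type*} {d : ℕ} (B lam : ℝ) (T : ℕ)
    (x : ℕ → Ω → EuclideanSpace ℝ (Fin d)) (ε : ℕ → Ω → ℝ) (t : ℕ) : Set Ω :=
  {ω | d * Real.log (1 + ((t : ℝ) * B ^ 2 / lam) / (1 / (T : ℝ))) <
    selfNormalizedNoise lam (fun s => x s ω) (fun s => ε s ω) t}

theorem failureSet_zero {Ω : Type*} {d : ℕ} (B lam : ℝ) (T : ℕ)
    (x : ℕ → Ω → EuclideanSpace ℝ (Fin d)) (ε : ℕ → Ω → ℝ) : failureSet B lam T x ε 0 = ∅ := by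
  simp [failureSet, selfNormalizedNoise_zero]

section Failure

variable {Ω : Type*} [mΩ : MeasurableSpace Ω] {μ : Measure Ω} [IsProbabilityMeasure μ] {ℱ : Filtration ℕ mΩ} {T : ℕ}
  {ε : ℕ → Ω → ℝ} {B lam lam₀ lam₁ κ : ℝ}

/-- At the threshold `d log b` the mixture bound is `(a/b)^{d/2}`. The bound `L = κB` makes `a/b =
O(1/T)` uniformly in `B`, and `d/2 ≥ 1` retains this rate. -/
theorem sum_failureSet_le_of_two_le {d : ℕ} {x : ℕ → Ω → EuclideanSpace ℝ (Fin d)} (hd : 2 ≤ d)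
    (hT : 1 ≤ T) (hB : 1 ≤ B) (hlam : 0 < lam) (hlam₁ : lam ≤ lam₁)
    (hε : IsSubGaussianNoise μ ℱ T ε) (hx : ∀ t < T, StronglyMeasurable[ℱ t] (x t))
    (hL : ∀ t < T, ∀ ω, ‖x t ω‖ ≤ κ * B) :
    ∑ t ∈ Finset.range T, μ.real (failureSet B lam T x ε t) ≤ lam₁ + κ ^ 2 := by
  have hT1 : (1 : ℝ) ≤ T := by exact_mod_cast hT
  have hT0 : (0 : ℝ) < T := by linarith
  have hM : 0 < lam₁ + κ ^ 2 := by have := hlam.trans_le hlam₁; positivity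
  have key : ∀ t ∈ Finset.range T, μ.real (failureSet B lam T x ε t) ≤ (lam₁ + κ ^ 2) / T := by
    intro t ht
    have ht := Finset.mem_range.1 ht
    rcases Nat.eq_zero_or_pos t with rfl | ht0
    · rw [failureSet_zero]; simp; positivity
    have ht1 : (1 : ℝ) ≤ t := by exact_mod_cast ht0
    -- If the target is at least one it is trivial; otherwise `a/b ≤ 1`, which `hpow` needs to lower
    -- the exponent to one.
    rcases le_total 1 ((lam₁ + κ ^ 2) / T) with h1 | h1
    · exact measureReal_le_one.trans h1
    set b := 1 + ((t : ℝ) * B ^ 2 / lam) / (1 / (T : ℝ)) with hb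
    have hb0 : 0 < b := by positivity
    have h := hε.measure_selfNormalizedNoise_ge_le hx ht.le hlam
      (fun s hs => hL s (hs.trans ht)) (d * Real.log b)
    have he : Real.exp (-(d * Real.log b / 2)) = (b ^ (d / 2 : ℝ))⁻¹ := by
      rw [Real.exp_neg, Real.rpow_def_of_pos hb0]
      congr 2; ring
    set a := 1 + t * (κ * B) ^ 2 / lam with ha
    have ha0 : 0 < a := by positivity
    rw [he, ← div_eq_mul_inv, ← Real.div_rpow ha0.le hb0.le] at h
    have hab : a / b ≤ (lam₁ + κ ^ 2) / T := by
      rw [div_le_div_iff₀ hb0 hT0]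
      have hbe : b * lam = lam + t * B ^ 2 * T := by rw [hb]; field_simp
      have hae : a * lam = lam + t * (κ * B) ^ 2 := by rw [ha]; field_simp
      refine le_of_mul_le_mul_right ?_ hlam
      calc a * T * lam = (a * lam) * T := by ring
        _ = (lam + t * (κ * B) ^ 2) * T := by rw [hae]
        _ ≤ (lam₁ + κ ^ 2) * (t * B ^ 2 * T) := by
          have hB2 : 1 ≤ t * B ^ 2 := by nlinarith
          have : lam ≤ lam₁ * (t * B ^ 2) := by nlinarith
          have : (lam + t * (κ * B) ^ 2) ≤ (lam₁ + κ ^ 2) * (t * B ^ 2) := by nlinarith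
          calc _ ≤ (lam₁ + κ ^ 2) * (t * B ^ 2) * T := mul_le_mul_of_nonneg_right this hT0.le
            _ = _ := by ring
        _ ≤ (lam₁ + κ ^ 2) * (b * lam) := by
          rw [hbe]; exact mul_le_mul_of_nonneg_left (by linarith) hM.le
        _ = (lam₁ + κ ^ 2) * b * lam := by ring
    have hpow : (a / b) ^ (d / 2 : ℝ) ≤ a / b := by
      have hd2 : (2 : ℝ) ≤ d := by exact_mod_cast hd
      have := Real.rpow_le_rpow_of_exponent_ge (div_pos ha0 hb0) (hab.trans h1)
        (show (1 : ℝ) ≤ d / 2 by linarith)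
      rwa [Real.rpow_one] at this
    refine le_trans (measureReal_mono ?_ (measure_ne_top _ _)) (h.trans (hpow.trans hab))
    intro ω hω
    rw [failureSet, Set.mem_ofPred_eq] at hω
    exact hω.le
  refine (Finset.sum_le_sum key).trans (le_of_eq ?_)
  rw [Finset.sum_const, Finset.card_range, nsmul_eq_mul]
  field_simp

/-- The constant of the failure bound in dimension one. -/
noncomputable def failureConstOne (lam₀ lam₁ κ : ℝ) : ℝ :=
  2 * (((4 + logFactor (1 / lam₀)) * logFactor (κ ^ 2 / lam₀) / 2 + 4) *
    (2 * Real.exp (1 / 2) * Real.sqrt lam₁))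

/-- The grid bound at level `log b` is `b^{-1/2}`, of order `(tT)^{-1/2}`, up to logarithms. Since
`∑ t^{-1/2} ≤ 2√T`, the sum is polylogarithmic. Here `L = κ√T` keeps the grid size logarithmic in
`T` alone. -/
theorem sum_failureSet_one_le {x : ℕ → Ω → EuclideanSpace ℝ (Fin 1)}
    (hT : 1 ≤ T) (hB : 1 ≤ B) (h₀ : 0 < lam₀) (hlam₀ : lam₀ ≤ lam) (hlam₁ : lam ≤ lam₁)
    (hε : IsSubGaussianNoise μ ℱ T ε) (hx : ∀ t < T, StronglyMeasurable[ℱ t] (x t))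
    (hL : ∀ t < T, ∀ ω, ‖x t ω‖ ≤ κ * Real.sqrt T) :
    ∑ t ∈ Finset.range T, μ.real (failureSet B lam T x ε t) ≤
      failureConstOne lam₀ lam₁ κ * Real.log (1 + T) ^ 2 := by
  have hlam : 0 < lam := h₀.trans_le hlam₀
  have hT1 : (1 : ℝ) ≤ T := by exact_mod_cast hT
  have hT0 : (0 : ℝ) < T := by linarith
  set Λ := Real.log (1 + T) with hΛ
  have hΛ2 : 1 / 2 ≤ Λ := one_half_le_log_one_add hT
  set c1 := logFactor (κ ^ 2 / lam₀) with hc1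
  set c2 := logFactor (1 / lam₀) with hc2
  have hc1' : 2 ≤ c1 := two_le_logFactor (by positivity)
  have hc2' : 2 ≤ c2 := two_le_logFactor (by positivity)
  set W := ((4 + c2) * c1 / 2 + 4) * (2 * Real.exp (1 / 2) * Real.sqrt lam₁) with hW
  have key : ∀ t ∈ Finset.range T, μ.real (failureSet B lam T x ε t) ≤
      W * Λ ^ 2 / Real.sqrt T * (1 / Real.sqrt t) := by
    intro t ht
    have ht := Finset.mem_range.1 ht
    rcases Nat.eq_zero_or_pos t with rfl | ht0
    · rw [failureSet_zero]; simp
    have ht1 : (1 : ℝ) ≤ t := by exact_mod_cast ht0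
    have htT : (t : ℝ) ≤ T := by exact_mod_cast ht.le
    -- The factor `B² ≥ 1` is dropped from the threshold: the event only grows, and the grid size,
    -- which depends on `log b`, becomes free of `B`.
    set b := 1 + (t : ℝ) * T / lam with hb
    have hb1 : 1 < b := by
      have : 0 < (t : ℝ) * T / lam := by positivity
      linarith
    have hb0 : 0 < b := by linarith
    set ℓ := Real.log b with hℓ
    have hℓ0 : 0 < ℓ := Real.log_pos hb1
    have hsub : failureSet B lam T x ε t ⊆
        {ω | ℓ ≤ selfNormalizedNoise lam (fun s => x s ω) (fun s => ε s ω) t} := by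
      intro ω hω
      rw [failureSet, Set.mem_ofPred_eq] at hω
      refine le_trans ?_ hω.le
      rw [Nat.cast_one, one_mul]
      refine Real.log_le_log hb0 ?_
      have h1 : (t : ℝ) * B ^ 2 / lam / (1 / (T : ℝ)) = (t : ℝ) * T / lam * B ^ 2 := by
        field_simp
      have h2 : 0 ≤ (t : ℝ) * T / lam := by positivity
      have h3 : (t : ℝ) * T / lam * 1 ≤ (t : ℝ) * T / lam * B ^ 2 :=
        mul_le_mul_of_nonneg_left (one_le_pow₀ hB) h2
      rw [h1, hb]
      linarith
    set R := Real.sqrt (1 + κ ^ 2 / lam₀ * (T : ℝ) ^ 2) with hR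
    have hR1 : 1 ≤ R := Real.one_le_sqrt.2 (by
      have : 0 ≤ κ ^ 2 / lam₀ * (T : ℝ) ^ 2 := by positivity
      linarith)
    have hRb : lam + t * (κ * Real.sqrt T) ^ 2 ≤ lam * R ^ 2 := by
      rw [hR, Real.sq_sqrt (by positivity), mul_pow, Real.sq_sqrt hT0.le, mul_add, mul_one]
      have h1 : κ ^ 2 ≤ lam * (κ ^ 2 / lam₀) := by
        rw [← mul_div_assoc, le_div_iff₀ h₀]
        nlinarith [sq_nonneg κ]
      have h2 : t * (κ ^ 2 * T) ≤ κ ^ 2 * T ^ 2 := by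
        have : 0 ≤ κ ^ 2 * T := by positivity
        nlinarith
      have h3 : κ ^ 2 * (T : ℝ) ^ 2 ≤ lam * (κ ^ 2 / lam₀) * T ^ 2 :=
        mul_le_mul_of_nonneg_right h1 (by positivity)
      linarith
    have h := hε.measure_selfNormalizedNoise_one_ge_le hx ht.le hlam
      (fun s hs => hL s (hs.trans ht)) hR1 hRb hℓ0
    have hlogR : Real.log R ≤ c1 * Λ / 2 := by
      rw [hR, Real.log_sqrt (by positivity)]
      have := log_one_add_mul_sq_le (c := κ ^ 2 / lam₀) (by positivity) hT
      linarith
    have hlogR0 := Real.log_nonneg hR1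
    have hℓle : ℓ ≤ c2 * Λ := by
      refine le_trans (Real.log_le_log hb0 ?_)
        (log_one_add_mul_sq_le (c := 1 / lam₀) (by positivity) hT)
      have : (t : ℝ) * T / lam ≤ (T : ℝ) ^ 2 / lam₀ := by
        refine div_le_div₀ (by positivity) ?_ h₀ hlam₀
        nlinarith
      rw [hb, one_div_mul_eq_div]
      linarith
    have hsq := sqrt_le_one_add hℓ0.le
    have hfac := two_mul_gridSize_le (Real.sqrt_nonneg ℓ) hsq hℓle hlogR0 hlogR hΛ2
    have hexp := exp_one_sub_log_div_two_le hlam hlam₁ ht1 hT0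
    refine (measureReal_mono hsub (measure_ne_top _ _)).trans (h.trans ?_)
    refine (mul_le_mul hfac hexp (Real.exp_pos _).le (by positivity)).trans (le_of_eq ?_)
    rw [hW]
    field_simp
  refine (Finset.sum_le_sum key).trans ?_
  rw [← Finset.mul_sum]
  have hsum : ∑ t ∈ Finset.range T, 1 / Real.sqrt t ≤ 2 * Real.sqrt T :=
    le_trans (Finset.sum_le_sum_of_subset_of_nonneg
      (Finset.range_mono (Nat.le_succ T)) fun _ _ _ => by positivity) (sum_one_div_sqrt_le T)
  have hsT : 0 < Real.sqrt T := Real.sqrt_pos.2 hT0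
  refine (mul_le_mul_of_nonneg_left hsum (by positivity)).trans (le_of_eq ?_)
  rw [failureConstOne, ← hc1, ← hc2, ← hW]
  field_simp

/-- The expected number of failing rounds is polylogarithmic. -/
theorem sum_failureSet_le {d : ℕ} {x : ℕ → Ω → EuclideanSpace ℝ (Fin d)} (hd : 1 ≤ d)
    (hT : 1 ≤ T) (hB : 1 ≤ B) (h₀ : 0 < lam₀) (hlam₀ : lam₀ ≤ lam) (hlam₁ : lam ≤ lam₁)
    (hκ : 0 ≤ κ) (hε : IsSubGaussianNoise μ ℱ T ε)
    (hx : ∀ t < T, StronglyMeasurable[ℱ t] (x t))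
    (hL : ∀ t < T, ∀ ω, ‖x t ω‖ ≤ κ * min B (Real.sqrt T)) :
    ∑ t ∈ Finset.range T, μ.real (failureSet B lam T x ε t) ≤
      (4 * (lam₁ + κ ^ 2) + failureConstOne lam₀ lam₁ κ) * Real.log (1 + T) ^ 2 := by
  have hΛ2 := one_half_le_log_one_add hT
  have hlam : 0 < lam := h₀.trans_le hlam₀
  have hM : 0 < lam₁ + κ ^ 2 := by have := hlam.trans_le hlam₁; positivity
  have hC : 0 ≤ failureConstOne lam₀ lam₁ κ := by
    have := two_le_logFactor (c := κ ^ 2 / lam₀) (by positivity)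
    have := two_le_logFactor (c := 1 / lam₀) (by positivity)
    unfold failureConstOne
    positivity
  have hsq : 1 ≤ 4 * Real.log (1 + T) ^ 2 := by nlinarith
  rcases hd.eq_or_lt with rfl | hd
  · refine (sum_failureSet_one_le hT hB h₀ hlam₀ hlam₁ hε hx fun t ht ω =>
      (hL t ht ω).trans (mul_le_mul_of_nonneg_left (min_le_right _ _) hκ)).trans ?_
    nlinarith
  · refine (sum_failureSet_le_of_two_le hd hT hB hlam hlam₁ hε hx fun t ht ω =>
      (hL t ht ω).trans (mul_le_mul_of_nonneg_left (min_le_left _ _) hκ)).trans ?_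
    nlinarith

end Failure

/-! ### Summing the losses and collecting constants. -/

/-- Deterministic summation of per-round losses: good rounds lose at most `2 β w`, every round
loses at most `D`, and bad rounds are counted by `b`. -/
theorem sum_loss_le {T : ℕ} {u w b : ℕ → ℝ} {β D P : ℝ} (hβ : 0 ≤ β) (hD : 0 ≤ D)
    (hw : ∀ t < T, 0 ≤ w t) (hb : ∀ t < T, 0 ≤ b t) (huD : ∀ t < T, u t ≤ D)
    (hu : ∀ t < T, u t ≤ 2 * β * w t ∨ b t = 1)
    (hP : ∑ t ∈ Finset.range T, min 1 (w t ^ 2) ≤ P) :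
    ∑ t ∈ Finset.range T, u t ≤
      2 * β * Real.sqrt (T * P) + D * P + D * ∑ t ∈ Finset.range T, b t := by
  -- The three terms pay respectively for good rounds with `w t ≤ 1`, good rounds with `w t ≥ 1`,
  -- and bad rounds.
  have h1 : ∀ t ∈ Finset.range T,
      u t ≤ 2 * β * min 1 (w t) + D * min 1 (w t ^ 2) + D * b t := by
    intro t ht
    have ht := Finset.mem_range.1 ht
    have hw := hw t ht
    have h1 : 0 ≤ 2 * β * min 1 (w t) := mul_nonneg (by positivity) (le_min zero_le_one hw)
    have h2 : 0 ≤ D * min 1 (w t ^ 2) := mul_nonneg hD (le_min zero_le_one (sq_nonneg _))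
    have h3 : 0 ≤ D * b t := mul_nonneg hD (hb t ht)
    rcases hu t ht with h | h
    · rcases le_total (w t) 1 with h4 | h4
      · rw [min_eq_right h4] at h1 ⊢; linarith
      · rw [min_eq_left (one_le_pow₀ h4)] at h2 ⊢
        linarith [huD t ht]
    · rw [h] at h3 ⊢
      linarith [huD t ht]
  have h2 : ∑ t ∈ Finset.range T, min 1 (w t) ≤ Real.sqrt (T * P) := by
    refine Real.le_sqrt_of_sq_le ?_
    refine (sq_sum_le_card_mul_sum_sq (s := Finset.range T)).trans ?_
    rw [Finset.card_range]
    refine mul_le_mul_of_nonneg_left (le_trans (Finset.sum_le_sum fun t ht => ?_) hP)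
      (Nat.cast_nonneg T)
    have hw := hw t (Finset.mem_range.1 ht)
    rcases le_total (w t) 1 with h4 | h4
    · rw [min_eq_right h4, min_eq_right (pow_le_one₀ hw h4)]
    · rw [min_eq_left h4, min_eq_left (one_le_pow₀ h4), one_pow]
  refine (Finset.sum_le_sum h1).trans ?_
  rw [Finset.sum_add_distrib, Finset.sum_add_distrib, ← Finset.mul_sum, ← Finset.mul_sum,
    ← Finset.mul_sum]
  have h3 := mul_le_mul_of_nonneg_left h2 (show 0 ≤ 2 * β by positivity)
  have h4 := mul_le_mul_of_nonneg_left hP hD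
  linarith

theorem confRadius_mono {d : ℕ} {B lam δ : ℝ} (hlam : 0 < lam) (hδ : 0 < δ) {s t : ℕ}
    (h : s ≤ t) : confRadius d B lam δ s ≤ confRadius d B lam δ t := by
  have h1 : (s : ℝ) ≤ t := by exact_mod_cast h
  unfold confRadius
  gcongr

theorem confRadius_nonneg {d : ℕ} {B lam δ : ℝ} (hB : 0 ≤ B) (t : ℕ) :
    0 ≤ confRadius d B lam δ t := by
  unfold confRadius
  positivity

theorem sqrt_le_two_mul_mul {y c z : ℝ} (hc : 1 ≤ c) (hz : 1 / 2 ≤ z) (hy : y ≤ c * z) :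
    Real.sqrt y ≤ 2 * c * z := by
  refine Real.sqrt_le_iff.2 ⟨by positivity, hy.trans ?_⟩
  have h1 : 1 ≤ c * (2 * z) := by nlinarith
  nlinarith

/-- The factor in the bound of the confidence radius. -/
noncomputable def radiusConst (lam₀ lam₁ : ℝ) : ℝ :=
  2 * (logFactor (1 / lam₀) + 4) + 2 * Real.sqrt lam₁

/-- The radius contains `√(log B²)`; `log B ≤ B - 1` lets the linear factor `B` of the bound absorb
it, so no logarithm of `B` survives. -/
theorem confRadius_le {d T : ℕ} {B lam lam₀ lam₁ : ℝ} (hd : 1 ≤ d) (hT : 1 ≤ T) (hB : 1 ≤ B)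
    (h₀ : 0 < lam₀) (hlam₀ : lam₀ ≤ lam) (hlam₁ : lam ≤ lam₁) :
    confRadius d B lam (1 / (T : ℝ)) T ≤
      radiusConst lam₀ lam₁ * (Real.sqrt d * B * Real.log (1 + T)) := by
  have hlam : 0 < lam := h₀.trans_le hlam₀
  have hT1 : (1 : ℝ) ≤ T := by exact_mod_cast hT
  have hd1 : (1 : ℝ) ≤ Real.sqrt d := Real.one_le_sqrt.2 (by exact_mod_cast hd)
  have hΛ := one_half_le_log_one_add hT
  set Λ := Real.log (1 + T)
  have hc := two_le_logFactor (c := 1 / lam₀) (by positivity)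
  have hBΛ : 1 / 2 ≤ B * Λ := by nlinarith
  have hY : Real.log (1 + ((T : ℝ) * B ^ 2 / lam) / (1 / (T : ℝ))) ≤
      (logFactor (1 / lam₀) + 4) * (B * Λ) := by
    have h1 : 1 + ((T : ℝ) * B ^ 2 / lam) / (1 / (T : ℝ)) ≤
        (1 + 1 / lam₀ * (T : ℝ) ^ 2) * B ^ 2 := by
      have h2 : ((T : ℝ) * B ^ 2 / lam) / (1 / (T : ℝ)) = 1 / lam * (T ^ 2 * B ^ 2) := by
        field_simp
      have h3 : 1 / lam * ((T : ℝ) ^ 2 * B ^ 2) ≤ 1 / lam₀ * (T ^ 2 * B ^ 2) :=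
        mul_le_mul_of_nonneg_right (one_div_le_one_div_of_le h₀ hlam₀) (by positivity)
      have h4 : 1 ≤ B ^ 2 := one_le_pow₀ hB
      rw [h2]
      linarith
    have h2 := Real.log_le_log (by positivity) h1
    rw [Real.log_mul (by positivity) (by positivity), Real.log_pow] at h2
    have h3 := log_one_add_mul_sq_le (c := 1 / lam₀) (by positivity) hT
    have h4 := Real.log_le_sub_one_of_pos (show 0 < B by linarith)
    push_cast at h2
    have h5 : logFactor (1 / lam₀) * Λ ≤ logFactor (1 / lam₀) * (B * Λ) :=
      mul_le_mul_of_nonneg_left (by nlinarith) (by linarith)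
    nlinarith
  have h1 := sqrt_le_two_mul_mul (by linarith) hBΛ hY
  have h2 : Real.sqrt lam * B ≤ 2 * Real.sqrt lam₁ * (Real.sqrt d * B * Λ) := by
    have h3 := Real.sqrt_le_sqrt hlam₁
    have h4 : B ≤ 2 * (Real.sqrt d * B * Λ) := by
      have : B * Λ ≤ Real.sqrt d * (B * Λ) := le_mul_of_one_le_left (by positivity) hd1
      nlinarith
    calc Real.sqrt lam * B ≤ Real.sqrt lam₁ * (2 * (Real.sqrt d * B * Λ)) :=
          mul_le_mul h3 h4 (by positivity) (by positivity)
      _ = _ := by ring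
  have h3 := mul_le_mul_of_nonneg_left h1 (Real.sqrt_nonneg (d : ℝ))
  unfold confRadius radiusConst
  rw [Real.sqrt_mul (Nat.cast_nonneg d)]
  linarith

/-- The constant in front of `d B √T log² (1 + T)`. -/
noncomputable def regretConst (lam₀ lam₁ κ : ℝ) (m : ℕ) : ℝ :=
  4 * radiusConst lam₀ lam₁ * logFactor (κ ^ 2 / lam₀) + 8 * κ * logFactor (κ ^ 2 / lam₀) +
    2 * κ * ((m + 1) * (4 * (lam₁ + κ ^ 2) + failureConstOne lam₀ lam₁ κ))

theorem loss_bound_le {d T m : ℕ} {B lam lam₀ lam₁ κ L F : ℝ} (hd : 1 ≤ d) (hT : 1 ≤ T)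
    (hB : 1 ≤ B) (h₀ : 0 < lam₀) (hlam₀ : lam₀ ≤ lam) (hlam₁ : lam ≤ lam₁) (hκ : 0 ≤ κ)
    (hL0 : 0 ≤ L) (hL : L ≤ κ * Real.sqrt T)
    (hF : F ≤ (m + 1) * ((4 * (lam₁ + κ ^ 2) + failureConstOne lam₀ lam₁ κ) *
      Real.log (1 + T) ^ 2)) (hF0 : 0 ≤ F) :
    2 * confRadius d B lam (1 / (T : ℝ)) T *
        Real.sqrt (T * (2 * (d * Real.log (1 + T * L ^ 2 / lam)))) +
      2 * B * L * (2 * (d * Real.log (1 + T * L ^ 2 / lam))) + 2 * B * L * F ≤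
    regretConst lam₀ lam₁ κ m * (d * B * Real.sqrt T) * Real.log (1 + T) ^ 2 := by
  have hlam : 0 < lam := h₀.trans_le hlam₀
  have hT1 : (1 : ℝ) ≤ T := by exact_mod_cast hT
  have hd1 : (1 : ℝ) ≤ d := by exact_mod_cast hd
  have hΛ := one_half_le_log_one_add hT
  have hβ := confRadius_le hd hT hB h₀ hlam₀ hlam₁
  have hβ0 := confRadius_nonneg (d := d) (lam := lam) (δ := 1 / (T : ℝ))
    (zero_le_one.trans hB) T
  set Λ := Real.log (1 + T)
  set c := logFactor (κ ^ 2 / lam₀) with hc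
  have hc2 : 2 ≤ c := two_le_logFactor (by positivity)
  set sT := Real.sqrt T
  have hsT : sT ^ 2 = T := Real.sq_sqrt (Nat.cast_nonneg T)
  set sd := Real.sqrt (d : ℝ)
  have hsd : sd ^ 2 = d := Real.sq_sqrt (Nat.cast_nonneg d)
  have hsT0 : 0 ≤ sT := Real.sqrt_nonneg _
  have hsd0 : 0 ≤ sd := Real.sqrt_nonneg _
  set ρ := radiusConst lam₀ lam₁ with hρ
  have hlog : Real.log (1 + T * L ^ 2 / lam) ≤ c * Λ := by
    refine le_trans (Real.log_le_log (by positivity) ?_)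
      (log_one_add_mul_sq_le (c := κ ^ 2 / lam₀) (by positivity) hT)
    have h1 : L ^ 2 ≤ κ ^ 2 * T := by
      rw [← hsT, ← mul_pow]; exact pow_le_pow_left₀ hL0 hL 2
    have h2 : T * L ^ 2 / lam ≤ T * (κ ^ 2 * T) / lam₀ :=
      div_le_div₀ (by positivity) (mul_le_mul_of_nonneg_left h1 (by positivity)) h₀ hlam₀
    have h3 : T * (κ ^ 2 * T) / lam₀ = κ ^ 2 / lam₀ * (T : ℝ) ^ 2 := by ring
    linarith
  have hP : 2 * (d * Real.log (1 + T * L ^ 2 / lam)) ≤ 2 * (d * (c * Λ)) := by gcongr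
  have hlog0 : 0 ≤ Real.log (1 + T * L ^ 2 / lam) := Real.log_nonneg (by
    have : 0 ≤ T * L ^ 2 / lam := by positivity
    linarith)
  have hroot : Real.sqrt (T * (2 * (d * Real.log (1 + T * L ^ 2 / lam)))) ≤
      sT * sd * (2 * c * Λ) := by
    refine Real.sqrt_le_iff.2 ⟨by positivity, ?_⟩
    refine (mul_le_mul_of_nonneg_left hP (by positivity)).trans ?_
    rw [mul_pow, mul_pow, hsT, hsd]
    have h1 : 1 ≤ 2 * c * Λ := by nlinarith
    have h2 : 2 * c * Λ ≤ (2 * c * Λ) ^ 2 := le_self_pow₀ h1 (by norm_num)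
    have h3 := mul_le_mul_of_nonneg_left h2 (show (0 : ℝ) ≤ T * d by positivity)
    linarith
  have hD : 2 * B * L ≤ 2 * B * (κ * sT) := by gcongr
  have e1 : 2 * confRadius d B lam (1 / (T : ℝ)) T *
      Real.sqrt (T * (2 * (d * Real.log (1 + T * L ^ 2 / lam)))) ≤
      4 * ρ * c * (d * B * sT) * Λ ^ 2 := by
    calc _ ≤ 2 * (ρ * (sd * B * Λ)) * (sT * sd * (2 * c * Λ)) :=
          mul_le_mul (by linarith) hroot (Real.sqrt_nonneg _) (by linarith)
      _ = 4 * ρ * c * (sd ^ 2 * B * sT) * Λ ^ 2 := by ring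
      _ = _ := by rw [hsd]
  have e2 : 2 * B * L * (2 * (d * Real.log (1 + T * L ^ 2 / lam))) ≤
      8 * κ * c * (d * B * sT) * Λ ^ 2 := by
    calc _ ≤ 2 * B * (κ * sT) * (2 * (d * (c * Λ))) :=
          mul_le_mul hD hP (by positivity) (by positivity)
      _ = (4 * κ * c * (d * B * sT)) * Λ := by ring
      _ ≤ (4 * κ * c * (d * B * sT)) * (2 * Λ ^ 2) :=
          mul_le_mul_of_nonneg_left (by nlinarith) (by positivity)
      _ = _ := by ring
  have e3 : 2 * B * L * F ≤ 2 * κ * ((m + 1) *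
      (4 * (lam₁ + κ ^ 2) + failureConstOne lam₀ lam₁ κ)) * (d * B * sT) * Λ ^ 2 := by
    calc _ ≤ 2 * B * (κ * sT) * F := mul_le_mul_of_nonneg_right hD hF0
      _ ≤ d * (2 * B * (κ * sT) * F) := le_mul_of_one_le_left (by positivity) hd1
      _ = d * (2 * B * (κ * sT)) * F := by ring
      _ ≤ d * (2 * B * (κ * sT)) * _ := mul_le_mul_of_nonneg_left hF (by positivity)
      _ = _ := by ring
  unfold regretConst
  rw [← hc, ← hρ]
  linarith

/-! ### Optimism and the integrated regret decomposition. -/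

section Run

variable {Ω : Type*} [mΩ : MeasurableSpace Ω] {μ : Measure Ω} [IsProbabilityMeasure μ]
  {ℱ : Filtration ℕ mΩ} {d m T : ℕ} {B lam : ℝ} {X : Set (EuclideanSpace ℝ (Fin d))}
  {f xopt : EuclideanSpace ℝ (Fin d)} {g : Fin m → EuclideanSpace ℝ (Fin d)}
  {ε εf : ℕ → Ω → ℝ} {εg : Fin m → ℕ → Ω → ℝ} {x : ℕ → Ω → EuclideanSpace ℝ (Fin d)}

theorem integrable_inner_action {L : ℝ} (hx : ∀ t < T, StronglyMeasurable[ℱ t] (x t))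
    (hL : ∀ t < T, ∀ ω, ‖x t ω‖ ≤ L) (θ : EuclideanSpace ℝ (Fin d)) {t : ℕ} (ht : t < T) :
    Integrable (fun ω => (inner ℝ θ (x t ω) : ℝ)) μ := by
  refine Integrable.of_bound (((stronglyMeasurable_const.inner (hx t ht)).mono
    (ℱ.le t)).aestronglyMeasurable) (‖θ‖ * L) (Filter.Eventually.of_forall fun ω => ?_)
  exact (norm_inner_le_norm _ _).trans (mul_le_mul_of_nonneg_left (hL t ht ω) (norm_nonneg _))

theorem integrable_sum_observation {L : ℝ} (hε : IsSubGaussianNoise μ ℱ T ε)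
    (hx : ∀ t < T, StronglyMeasurable[ℱ t] (x t)) (hL : ∀ t < T, ∀ ω, ‖x t ω‖ ≤ L)
    (θ : EuclideanSpace ℝ (Fin d)) :
    Integrable (fun ω => ∑ t ∈ Finset.range T, observation θ x ε t ω) μ := by
  refine integrable_finsetSum _ fun t ht => ?_
  have ht := Finset.mem_range.1 ht
  exact (integrable_inner_action hx hL θ ht).add
    ((hε t ht).2.integrable ((hε t ht).1.measurable.mono (ℱ.le _) le_rfl))

theorem integral_sum_observation {L : ℝ} (hε : IsSubGaussianNoise μ ℱ T ε)
    (hx : ∀ t < T, StronglyMeasurable[ℱ t] (x t)) (hL : ∀ t < T, ∀ ω, ‖x t ω‖ ≤ L)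
    (θ : EuclideanSpace ℝ (Fin d)) :
    ∫ ω, ∑ t ∈ Finset.range T, observation θ x ε t ω ∂μ =
      ∫ ω, ∑ t ∈ Finset.range T, (inner ℝ θ (x t ω) : ℝ) ∂μ := by
  have hεm : ∀ t < T, Measurable (ε t) := fun t ht =>
    (hε t ht).1.measurable.mono (ℱ.le _) le_rfl
  rw [integral_finsetSum _ fun t ht => (integrable_inner_action hx hL θ
    (Finset.mem_range.1 ht)), integral_finsetSum]
  · refine Finset.sum_congr rfl fun t ht => ?_
    have ht := Finset.mem_range.1 ht
    simp only [observation]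
    rw [integral_add (integrable_inner_action hx hL θ ht) ((hε t ht).2.integrable (hεm t ht)),
      (hε t ht).2.integral_eq_zero (ℱ.le t) (hεm t ht), add_zero]
  · intro t ht
    have ht := Finset.mem_range.1 ht
    exact (integrable_inner_action hx hL θ ht).add ((hε t ht).2.integrable (hεm t ht))

/-- The union over all unknown parameters of the failure events of round `t`. -/
def roundFailureSet {Ω : Type*} {d m : ℕ} (B lam : ℝ) (T : ℕ) (εf : ℕ → Ω → ℝ)
    (εg : Fin m → ℕ → Ω → ℝ) (x : ℕ → Ω → EuclideanSpace ℝ (Fin d)) (t : ℕ) : Set Ω :=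
  failureSet B lam T x εf t ∪ ⋃ i ∈ (Finset.univ : Finset (Fin m)), failureSet B lam T x (εg i) t

/-- Optimism: in a round without failure, neither the regret nor the constraint violation exceeds
twice the confidence width. -/
theorem IsUCBRun.loss_le {Ω : Type*} {εf : ℕ → Ω → ℝ} {εg : Fin m → ℕ → Ω → ℝ}
    {x : ℕ → Ω → EuclideanSpace ℝ (Fin d)}
    (hrun : IsUCBRun B lam (1 / (T : ℝ)) T X f g εf εg x) (hlam : 0 < lam)
    (hf : ‖f‖ ≤ B) (hg : ∀ i, ‖g i‖ ≤ B) (hopt : xopt ∈ benchmarkSet X g) {t : ℕ} (ht : t < T)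
    {ω : Ω} (hω : ω ∉ roundFailureSet B lam T εf εg x t) :
    (inner ℝ f xopt - inner ℝ f (x t ω) ≤ 2 * confRadius d B lam (1 / (T : ℝ)) t *
        designWidth lam (fun s => x s ω) t) ∧
      ∀ i, inner ℝ (g i) (x t ω) ≤ 2 * confRadius d B lam (1 / (T : ℝ)) t *
        designWidth lam (fun s => x s ω) t := by
  have hω1 : ω ∉ failureSet B lam T x εf t := fun h => hω (Or.inl h)
  have hω2 : ∀ i, ω ∉ failureSet B lam T x (εg i) t := fun i h =>
    hω (Or.inr (Set.mem_biUnion (Finset.mem_coe.2 (Finset.mem_univ i)) h))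
  have hfC : f ∈ confSet B lam (1 / (T : ℝ)) (fun s => x s ω)
      (fun s => observation f x εf s ω) t := by
    rw [failureSet, Set.mem_ofPred_eq, not_lt] at hω1
    exact mem_confSet hlam hf hω1
  have hgC : ∀ i, g i ∈ confSet B lam (1 / (T : ℝ)) (fun s => x s ω)
      (fun s => observation (g i) x (εg i) s ω) t := by
    intro i
    have h := hω2 i
    rw [failureSet, Set.mem_ofPred_eq, not_lt] at h
    exact mem_confSet hlam (hg i) h
  -- This triple makes the program feasible, so the played action comes from a maximizer, whose
  -- value is at least `⟨f, xopt⟩`.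
  have hmem := (show (xopt, f, g) ∈ optimisticFeasible X _ _ from
    ⟨hopt.1, hfC, fun i => ⟨hgC i, hopt.2 i⟩⟩)
  obtain ⟨f', g', hfeas, hmax⟩ := (hrun ω t ht).2 ⟨_, hmem⟩
  refine ⟨?_, fun i => ?_⟩
  · have h1 := hmax _ hmem
    have h2 := inner_sub_le_of_mem_confSet hlam hfeas.2.1 hfC
    rw [inner_sub_left] at h2
    simp only at h1 h2
    linarith
  · have h1 := (hfeas.2.2 i).2
    have h2 := inner_sub_le_of_mem_confSet hlam (hgC i) (hfeas.2.2 i).1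
    rw [inner_sub_left] at h2
    simp only at h1 h2
    linarith

/-- Integrated form of the regret decomposition for an arbitrary bounded loss. -/
theorem integral_sum_loss_le {L D F : ℝ} (hlam : 0 < lam) (hB : 0 ≤ B) (hT : 1 ≤ T)
    (hD : 0 ≤ D) (hL : ∀ t < T, ∀ ω, ‖x t ω‖ ≤ L) {u : ℕ → Ω → ℝ} {N : ℕ → Set Ω}
    (hu : ∀ t < T, Integrable (u t) μ) (huD : ∀ t < T, ∀ ω, u t ω ≤ D)
    (hgood : ∀ t < T, ∀ ω, ω ∉ N t → u t ω ≤ 2 * confRadius d B lam (1 / (T : ℝ)) t *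
      designWidth lam (fun s => x s ω) t)
    (hF : ∑ t ∈ Finset.range T, μ.real (N t) ≤ F) :
    ∫ ω, ∑ t ∈ Finset.range T, u t ω ∂μ ≤
      2 * confRadius d B lam (1 / (T : ℝ)) T *
        Real.sqrt (T * (2 * (d * Real.log (1 + T * L ^ 2 / lam)))) +
      D * (2 * (d * Real.log (1 + T * L ^ 2 / lam))) + D * F := by
  have hT0 : (0 : ℝ) < T := by exact_mod_cast hT
  set A := 2 * confRadius d B lam (1 / (T : ℝ)) T *
        Real.sqrt (T * (2 * (d * Real.log (1 + T * L ^ 2 / lam)))) +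
      D * (2 * (d * Real.log (1 + T * L ^ 2 / lam))) with hA
  -- The measurable hull has the same measure, so measurability of the failure events never has to
  -- be shown.
  let b : ℕ → Ω → ℝ := fun t => (toMeasurable μ (N t)).indicator 1
  have hbint : ∀ t, Integrable (b t) μ := fun t =>
    (integrable_const (1 : ℝ)).indicator (measurableSet_toMeasurable μ (N t))
  have hpt : ∀ ω, ∑ t ∈ Finset.range T, u t ω ≤ A + D * ∑ t ∈ Finset.range T, b t ω := by
    intro ω
    refine sum_loss_le (w := fun t => designWidth lam (fun s => x s ω) t)
      (confRadius_nonneg hB T) hD (fun t _ => weightedNorm_nonneg _ _)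
      (fun t _ => Set.indicator_nonneg (fun _ _ => zero_le_one) ω) (fun t ht => huD t ht ω)
      (fun t ht => ?_) (sum_min_one_designWidth_sq_le hlam fun s hs => hL s hs ω)
    by_cases h : ω ∈ toMeasurable μ (N t)
    · right; simp [b, h]
    · left
      refine (hgood t ht ω fun h' => h (subset_toMeasurable μ (N t) h')).trans ?_
      refine mul_le_mul_of_nonneg_right ?_ (weightedNorm_nonneg _ _)
      linarith [confRadius_mono (d := d) (B := B) hlam (one_div_pos.2 hT0) ht.le]
  have hsumint : Integrable (fun ω => ∑ t ∈ Finset.range T, b t ω) μ :=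
    integrable_finsetSum _ fun t _ => hbint t
  have h1 := integral_mono (integrable_finsetSum _ fun t ht => hu t (Finset.mem_range.1 ht))
    ((integrable_const A).add (hsumint.const_mul D)) hpt
  refine h1.trans ?_
  rw [integral_add' (integrable_const A) (hsumint.const_mul D), integral_const_mul,
    integral_finsetSum _ fun t _ => hbint t]
  have h2 : ∀ t, ∫ ω, b t ω ∂μ = μ.real (N t) := by
    intro t
    rw [integral_indicator_one (measurableSet_toMeasurable μ (N t)), Measure.real,
      measure_toMeasurable, Measure.real]
  simp only [h2, integral_const, probReal_univ, one_smul]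
  linarith [mul_le_mul_of_nonneg_left hF hD]

end Run

/-! ### Regret and constraint violation. -/

theorem mainTheorem5 :
    ∃ k : ℕ, ∀ (lam₀ lam₁ κ : ℝ) (m : ℕ), 0 < lam₀ → ∃ C : ℝ,
      ∀ (d T : ℕ) (B lam : ℝ), 1 ≤ T → 1 ≤ B → lam₀ ≤ lam → lam ≤ lam₁ →
      ∀ (X : Set (EuclideanSpace ℝ (Fin d))), IsCompact X → Convex ℝ X →
        (∀ x ∈ X, ‖x‖ ≤ κ * min B (Real.sqrt T)) →
      ∀ (f : EuclideanSpace ℝ (Fin d)) (g : Fin m → EuclideanSpace ℝ (Fin d)),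
        ‖f‖ ≤ B → (∀ i, ‖g i‖ ≤ B) →
      ∀ xopt ∈ benchmarkSet X g, (∀ z ∈ benchmarkSet X g, inner ℝ f z ≤ inner ℝ f xopt) →
      ∀ (Ω : Type*) (mΩ : MeasurableSpace Ω) (μ : Measure Ω) (_ : IsProbabilityMeasure μ)
        (ℱ : Filtration ℕ mΩ) (εf : ℕ → Ω → ℝ) (εg : Fin m → ℕ → Ω → ℝ)
        (x : ℕ → Ω → EuclideanSpace ℝ (Fin d)),
        IsSubGaussianNoise μ ℱ T εf → (∀ i, IsSubGaussianNoise μ ℱ T (εg i)) →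
        (∀ t < T, StronglyMeasurable[ℱ t] (x t)) →
        IsUCBRun B lam (1 / (T : ℝ)) T X f g εf εg x →
      (Integrable (fun ω => ∑ t ∈ Finset.range T, observation f x εf t ω) μ ∧
        banditRegret μ T f xopt εf x
          ≤ C * (d * B * Real.sqrt T) * Real.log (1 + T) ^ k) ∧
      ∀ i, Integrable (fun ω => ∑ t ∈ Finset.range T, observation (g i) x (εg i) t ω) μ ∧
        ∫ ω, ∑ t ∈ Finset.range T, observation (g i) x (εg i) t ω ∂μ
          ≤ C * (d * B * Real.sqrt T) * Real.log (1 + T) ^ k := by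
  refine ⟨2, fun lam₀ lam₁ κ m h₀ => ⟨regretConst lam₀ lam₁ κ m, ?_⟩⟩
  intro d T B lam hT hB hlam₀ hlam₁ X _ _ hX f g hf hg xopt hopt _ Ω mΩ μ hμ ℱ εf εg x hεf hεg
    hx hrun
  have hT1 : (1 : ℝ) ≤ T := by exact_mod_cast hT
  have hB0 : 0 ≤ B := zero_le_one.trans hB
  have hlam : 0 < lam := h₀.trans_le hlam₀
  have hmin : 0 < min B (Real.sqrt T) := lt_min (by linarith) (Real.sqrt_pos.2 (by linarith))
  -- The action set contains `xopt`, and a negative `κ` would give it a negative norm.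
  have hκ : 0 ≤ κ := by
    by_contra! h
    have h1 := (norm_nonneg _).trans (hX xopt hopt.1)
    nlinarith [mul_neg_of_neg_of_pos h hmin]
  set L := κ * min B (Real.sqrt T) with hLdef
  have hL0 : 0 ≤ L := mul_nonneg hκ hmin.le
  have hL : ∀ t < T, ∀ ω, ‖x t ω‖ ≤ L := fun t ht ω => hX _ (hrun ω t ht).1
  -- Regret gaps and constraint values satisfy the same per-round bounds, so one estimate serves
  -- both. In dimension zero the right side vanishes, and the loss must vanish too.
  have hbound : ∀ u : ℕ → Ω → ℝ, (∀ t < T, Integrable (u t) μ) →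
      (∀ t < T, ∀ ω, u t ω ≤ 2 * B * L) → (d = 0 → ∀ t ω, u t ω = 0) →
      (∀ t < T, ∀ ω, ω ∉ roundFailureSet B lam T εf εg x t → u t ω ≤
        2 * confRadius d B lam (1 / (T : ℝ)) t * designWidth lam (fun s => x s ω) t) →
      ∫ ω, ∑ t ∈ Finset.range T, u t ω ∂μ ≤
        regretConst lam₀ lam₁ κ m * (d * B * Real.sqrt T) * Real.log (1 + T) ^ 2 := by
    intro u hu huD hu0 hgood
    rcases Nat.eq_zero_or_pos d with hd | hd
    · simp [hu0 hd, hd]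
    set Q := (4 * (lam₁ + κ ^ 2) + failureConstOne lam₀ lam₁ κ) * Real.log (1 + T) ^ 2 with hQ
    have hfail : ∑ t ∈ Finset.range T, μ.real (roundFailureSet B lam T εf εg x t) ≤
        (m + 1) * Q := by
      have h1 : ∀ ε : ℕ → Ω → ℝ, IsSubGaussianNoise μ ℱ T ε →
          ∑ t ∈ Finset.range T, μ.real (failureSet B lam T x ε t) ≤ Q := fun ε hε =>
        sum_failureSet_le hd hT hB h₀ hlam₀ hlam₁ hκ hε hx hL
      calc _ ≤ ∑ t ∈ Finset.range T, (μ.real (failureSet B lam T x εf t) +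
            ∑ i, μ.real (failureSet B lam T x (εg i) t)) :=
            Finset.sum_le_sum fun t _ => (measureReal_union_le _ _).trans
              (add_le_add le_rfl (measureReal_biUnion_finset_le _ _))
        _ ≤ Q + ∑ _i : Fin m, Q := by
            rw [Finset.sum_add_distrib, Finset.sum_comm]
            exact add_le_add (h1 εf hεf) (Finset.sum_le_sum fun i _ => h1 (εg i) (hεg i))
        _ = (m + 1) * Q := by simp; ring
    refine (integral_sum_loss_le hlam hB0 hT (by positivity) hL hu huD hgood le_rfl).trans ?_
    exact loss_bound_le hd hT hB h₀ hlam₀ hlam₁ hκ hL0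
      (mul_le_mul_of_nonneg_left (min_le_right _ _) hκ) hfail
      (Finset.sum_nonneg fun _ _ => measureReal_nonneg)
  have hinner : ∀ θ : EuclideanSpace ℝ (Fin d), ‖θ‖ ≤ B → ∀ z : EuclideanSpace ℝ (Fin d),
      ‖z‖ ≤ L → |(inner ℝ θ z : ℝ)| ≤ B * L := fun θ hθ z hz =>
    (abs_real_inner_le_norm θ z).trans (mul_le_mul hθ hz (norm_nonneg _) hB0)
  refine ⟨⟨integrable_sum_observation hεf hx hL f, ?_⟩, fun i =>
    ⟨integrable_sum_observation (hεg i) hx hL (g i), ?_⟩⟩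
  · have hconst : banditRegret μ T f xopt εf x =
        ∫ ω, ∑ t ∈ Finset.range T, ((inner ℝ f xopt : ℝ) - inner ℝ f (x t ω)) ∂μ := by
      have hint : Integrable (fun ω => ∑ t ∈ Finset.range T, (inner ℝ f (x t ω) : ℝ)) μ :=
        integrable_finsetSum _ fun t ht =>
          integrable_inner_action hx hL f (Finset.mem_range.1 ht)
      rw [banditRegret, integral_sum_observation hεf hx hL f]
      simp only [Finset.sum_sub_distrib, Finset.sum_const, Finset.card_range, nsmul_eq_mul]
      rw [integral_sub (integrable_const _) hint]
      simp
    rw [hconst]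
    refine hbound _ (fun t ht => (integrable_const _).sub (integrable_inner_action hx hL f ht))
      (fun t ht ω => ?_) (fun hd t ω => ?_)
      (fun t ht ω hω => (hrun.loss_le hlam hf hg hopt ht hω).1)
    · have h1 := abs_le.1 (hinner f hf _ (hL t ht ω))
      have h2 := abs_le.1 (hinner f hf _ (hX xopt hopt.1))
      linarith
    · subst hd
      simp [Subsingleton.elim f 0]
  · rw [integral_sum_observation (hεg i) hx hL (g i)]
    refine hbound _ (fun t ht => integrable_inner_action hx hL (g i) ht)
      (fun t ht ω => ?_) (fun hd t ω => ?_)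
      (fun t ht ω hω => (hrun.loss_le hlam hf hg hopt ht hω).2 i)
    · have h1 := abs_le.1 (hinner (g i) (hg i) _ (hL t ht ω))
      have h2 := mul_nonneg hB0 hL0
      linarith
    · subst hd
      simp [Subsingleton.elim (g i) 0]
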